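/- For $d \ge 2$ let $\mathbb{S}^{d-1}$ be the unit sphere of $\mathbb{R}^d$ with its uniform probability measure $S$, and let $\|\cdot\|_2$ be the norm of $L^2(S)$ and $\|\cdot\|_\infty$ the sup norm on $\mathbb{S}^{d-1}$. For $k \ge 0$ let $H_k^d$ be the space of restrictions to $\mathbb{S}^{d-1}$ of the homogeneous harmonic polynomials of degree $k$ in $d$ variables, let $$N_k^d = \frac{(2k+d-2)\,(k+d-3)!}{k!\,(d-2)!} = \dim H_k^d \qquad (k \ge 1), \qquad N_0^d = 1,$$ and for a continuous (real- or complex-valued) function $f$ on $\mathbb{S}^{d-1}$ let $f_k$ be the $L^2(S)$-orthogonal projection of $f$ onto $H_k^d$. Call $f$ sign-invariant if $f(\epsilon_1 x_1, \dots, \epsilon_d x_d) = f(x)$ for all $x \in \mathbb{S}^{d-1}$ and all $\epsilon \in \{\pm 1\}^d$. (a) Let $d \ge 2$ and let $f \in C(\mathbb{S}^{d-1})$ be sign-invariant. If, for some $k \ge 16 d^2$, $$\|f_k\|_\infty = \sup_{\epsilon \in \{\pm 1/\sqrt{d}\}^d} |f_k(\epsilon)|,$$ then $$\|f_k\|_\infty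 \le 2 \cdot 2^{-d/2} \sqrt{N_k^d}\, \|f_k\|_2 .$$ (b) Consequently, such functions are exponentially spread: let $f^{(d)} \in C(\mathbb{S}^{d-1})$, $d \ge 2$, be sign-invariant functions and let $I_d \subseteq \mathbb{N}$ be sets such that every $k \in I_d$ satisfies $k \ge 16 d^2$ and $\|f^{(d)}_k\|_\infty = \sup_{\epsilon \in \{\pm 1/\sqrt{d}\}^d} |f^{(d)}_k(\epsilon)|$. Then there exist numbers $c_{d,k} \ge 0$ ($d \ge 2$, $k \in I_d$) and constants $\varepsilon \in (0,1)$, $\alpha > 0$, $M > 0$, $C$ such that, for all $d \ge 2$, $$\|f_k^{(d)}\|_\infty \le c_{d,k} \sqrt{N_k^d}\, \|f^{(d)}\|_2 \quad \text{for all } k \in I_d, \qquad \Big(\sum_{k \in I_d} c_{d,k}^2\Big)^{1/2} \le C\, d^M\, \varepsilon^{d^\alpha}.$$ -/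

import Mathlib

open MeasureTheory
open scoped ComplexConjugate

noncomputable section

namespace SphHarm

/-- Euclidean space of dimension `d`. -/
abbrev Eucl (d : ℕ) : Type := EuclideanSpace ℝ (Fin d)

/-- The unit sphere in Euclidean space of dimension `d`. -/
abbrev Sph (d : ℕ) : Type := Metric.sphere (0 : Eucl d) 1

/-- The uniform measure on the unit sphere: surface measure, normalized to total mass one. -/
def unif (d : ℕ) : Measure (Sph d) :=
  ((volume : Measure (Eucl d)).toSphere Set.univ)⁻¹ • (volume : Measure (Eucl d)).toSphere

instance (d : ℕ) : IsFiniteMeasure (unif d) := by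
  refine ⟨?_⟩
  rw [unif, Measure.smul_apply, smul_eq_mul]
  exact lt_of_le_of_lt (ENNReal.inv_mul_le_one _) ENNReal.one_lt_top

instance (d : ℕ) : (unif d).IsOpenPosMeasure := by
  refine ⟨fun U hU hne => ?_⟩
  rw [unif, Measure.smul_apply, smul_eq_mul]
  exact mul_ne_zero (ENNReal.inv_ne_zero.2 (measure_ne_top _ _)) (hU.measure_ne_zero _ hne)

variable (𝕜 : Type*) [RCLike 𝕜]

/-- The Laplacian on polynomials in `d` variables. -/
def lap (d : ℕ) : MvPolynomial (Fin d) 𝕜 →ₗ[𝕜] MvPolynomial (Fin d) 𝕜 :=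
  ∑ i : Fin d, (MvPolynomial.pderiv i).toLinearMap ∘ₗ (MvPolynomial.pderiv i).toLinearMap

/-- Restriction of a polynomial in `d` variables to the unit sphere. -/
def restr (d : ℕ) : MvPolynomial (Fin d) 𝕜 →ₗ[𝕜] C(Sph d, 𝕜) where
  toFun p := ⟨fun x => MvPolynomial.eval (fun i => ((x : Eucl d) i : 𝕜)) p, by
    refine (MvPolynomial.continuous_eval p).comp (continuous_pi fun i => ?_)
    exact RCLike.continuous_ofReal.comp
      ((EuclideanSpace.proj (𝕜 := ℝ) i).continuous.comp continuous_subtype_val)⟩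
  map_add' p q := by ext x; simp
  map_smul' c p := by ext x; simp [MvPolynomial.smul_eval]

/-- The space `H_k^d` of spherical harmonics of degree `k`: the restrictions to the unit sphere of
the homogeneous harmonic polynomials of degree `k` in `d` variables. -/
def harm (d k : ℕ) : Submodule 𝕜 C(Sph d, 𝕜) :=
  (MvPolynomial.homogeneousSubmodule (Fin d) 𝕜 k ⊓ LinearMap.ker (lap 𝕜 d)).map (restr 𝕜 d)

instance (d k : ℕ) : FiniteDimensional 𝕜 (harm 𝕜 d k) := by
  have h1 : FiniteDimensional 𝕜 (MvPolynomial.homogeneousSubmodule (Fin d) 𝕜 k) :=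
    Module.Finite.iff_fg.2 (MvPolynomial.homogeneousSubmodule_fg (Fin d) 𝕜 k)
  have h2 : FiniteDimensional 𝕜
      (MvPolynomial.homogeneousSubmodule (Fin d) 𝕜 k ⊓ LinearMap.ker (lap 𝕜 d) :
        Submodule 𝕜 (MvPolynomial (Fin d) 𝕜)) :=
    Submodule.finiteDimensional_of_le inf_le_left
  unfold harm
  infer_instance

variable {𝕜} {d : ℕ}

/-- The inner product of `L²` of the sphere, linear in the first argument. -/
def ip (f g : C(Sph d, 𝕜)) : 𝕜 := ∫ x, f x * conj (g x) ∂(unif d)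

/-- The `L²` norm with respect to the uniform measure on the sphere. -/
def norm2 (f : C(Sph d, 𝕜)) : ℝ := √(∫ x, ‖f x‖ ^ 2 ∂(unif d))

theorem existsUnique_comp (k : ℕ) (f : C(Sph d, 𝕜)) :
    ∃! g : C(Sph d, 𝕜), g ∈ harm 𝕜 d k ∧ ∀ h ∈ harm 𝕜 d k, ip (f - g) h = 0 := by
  let T := ContinuousMap.toLp (E := 𝕜) 2 (unif d) 𝕜
  have hT : Function.Injective T := ContinuousMap.toLp_injective (unif d)
  have hip (u v : C(Sph d, 𝕜)) : inner 𝕜 (T v) (T u) = ip u v := by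
    simp only [T, ContinuousMap.inner_toLp, ip]
  let K : Submodule 𝕜 (Lp 𝕜 2 (unif d)) := (harm 𝕜 d k).map T.toLinearMap
  have : FiniteDimensional 𝕜 K := by unfold K; infer_instance
  obtain ⟨g, hg, hgT⟩ : K.starProjection (T f) ∈ K := K.starProjection_apply_mem (T f)
  replace hgT : T g = K.starProjection (T f) := hgT
  refine ⟨g, ⟨hg, fun h hh => ?_⟩, ?_⟩
  · rw [← hip, map_sub, hgT, ← inner_conj_symm,
      K.starProjection_inner_eq_zero (T f) (T h) ⟨h, hh, rfl⟩, map_zero]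
  · rintro g' ⟨hg', h'⟩
    apply hT
    rw [hgT]
    refine (K.eq_starProjection_of_mem_of_inner_eq_zero ⟨g', hg', rfl⟩ ?_).symm
    rintro _ ⟨h, hh, rfl⟩
    have := h' h hh
    rw [← hip, map_sub] at this
    rw [← inner_conj_symm]
    exact (congrArg conj this).trans (map_zero _)

/-- The degree `k` spherical harmonic component `f_k` of `f`: the orthogonal projection
of `f` onto `H_k^d` in `L²` of the sphere. -/
def comp (k : ℕ) (f : C(Sph d, 𝕜)) : C(Sph d, 𝕜) := (existsUnique_comp k f).choose

theorem comp_mem (k : ℕ) (f : C(Sph d, 𝕜)) : comp k f ∈ harm 𝕜 d k :=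
  (existsUnique_comp k f).choose_spec.1.1

theorem ip_sub_comp (k : ℕ) (f : C(Sph d, 𝕜)) :
    ∀ h ∈ harm 𝕜 d k, ip (f - comp k f) h = 0 :=
  (existsUnique_comp k f).choose_spec.1.2

theorem eq_comp (k : ℕ) (f g : C(Sph d, 𝕜)) (hg : g ∈ harm 𝕜 d k)
    (h : ∀ h ∈ harm 𝕜 d k, ip (f - g) h = 0) : g = comp k f :=
  (existsUnique_comp k f).choose_spec.2 g ⟨hg, h⟩

/-- The number `N_k^d` (for `d ≥ 2`), the classical dimension of `H_k^d`. The quotient of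
factorials is read as its value `1` for `k = 0`, where for `d = 2` it is not defined. -/
def N (k d : ℕ) : ℝ :=
  if k = 0 then 1
  else ((2 * k + d - 2 : ℕ) : ℝ) * ((k + d - 3).factorial : ℝ) /
    ((k.factorial : ℝ) * ((d - 2).factorial : ℝ))

/-- The coordinatewise product of a point of the sphere with a vector of signs. -/
def flip (e : Fin d → ℤˣ) (x : Sph d) : Sph d :=
  ⟨WithLp.toLp 2 fun i => ((e i : ℤ) : ℝ) * (x : Eucl d) i, by
    have hx : ‖(x : Eucl d)‖ = 1 := mem_sphere_zero_iff_norm.1 x.2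
    rw [mem_sphere_zero_iff_norm]
    refine Eq.trans ?_ hx
    rw [EuclideanSpace.norm_eq, EuclideanSpace.norm_eq]
    congr 1
    refine Finset.sum_congr rfl fun i _ => ?_
    rcases Int.units_eq_one_or (e i) with h | h <;> simp [h]⟩

/-- `f` is sign-invariant. -/
def SignInvariant (f : C(Sph d, 𝕜)) : Prop :=
  ∀ (e : Fin d → ℤˣ) (x : Sph d), f (flip e x) = f x

/-- The sign vectors, normalized to lie on the unit sphere: all coordinates are `± 1 / √d`. -/
def signVectors (d : ℕ) : Set (Sph d) :=
  {x | ∀ i, (x : Eucl d) i = 1 / √(d : ℝ) ∨ (x : Eucl d) i = -(1 / √(d : ℝ))}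

/-- The sup norm of `g` over the sphere equals its supremum over the sign vectors. -/
def PeaksAtSigns (g : C(Sph d, 𝕜)) : Prop :=
  ‖g‖ = ⨆ x : signVectors d, ‖g x‖

/-- Exponential spreadness of the components with index in `I d` of a sequence of functions,
one on the sphere of each dimension `d ≥ 2`: there are `c_{d,k} ≥ 0` with
`‖f_k‖_∞ ≤ c_{d,k} √N_k^d ‖f‖₂` for all `k ∈ I d`, and
`(∑_{k ∈ I d} c_{d,k}²)^{1/2} ≤ ε ^ (d ^ α) * O(d ^ M)` for some `0 < ε < 1` and `α, M > 0`. -/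
def ExpSpread (f : ∀ d : ℕ, C(Sph d, 𝕜)) (I : ℕ → Set ℕ) : Prop :=
  ∃ c : ℕ → ℕ → ℝ,
    (∀ d, 2 ≤ d → ∀ k ∈ I d,
      0 ≤ c d k ∧ ‖comp k (f d)‖ ≤ c d k * √(N k d) * norm2 (f d)) ∧
    ∃ ε α M C : ℝ, 0 < ε ∧ ε < 1 ∧ 0 < α ∧ 0 < M ∧
      ∀ d, 2 ≤ d → Summable (fun k : I d => c d k ^ 2) ∧
        √(∑' k : I d, c d k ^ 2) ≤ ε ^ ((d : ℝ) ^ α) * (C * (d : ℝ) ^ M)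

end SphHarm

end

/-! A spherical harmonic `h` of degree k is reproduced by zonal harmonics: with D = dim H_k and Z_e
the zonal harmonic normalized by Z_e(e) = 1, one has h(e) = D⟨h, Z_e⟩. If h is sign-invariant and x
is a sign vector, averaging over the 2^d flips of x gives 2^d h(x) = D⟨h, G⟩, where G is the sum of
the zonal harmonics with these poles. Reproducing G by itself gives D‖G‖² = 2^d S, where S sums the
zonal profile over the heights (∑ e_i)/d. Cauchy–Schwarz then yields the claim once S ≤ 4 and D ≤ N
are known (`norm_apply_signVector_le`).

The bound S ≤ 4 rests on Laplace's integral: the profile at height t is an average of Re (t +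
i√(1-t²) cos x)^k against sin^a x dx, a = d - 3, so it decays once k(1 - t²) is large compared with
d (`abs_zonal_le_two_pow`). The poles ±x contribute at most 1 each. Every other height satisfies |t|
≤ 1 - 2/d, and k ≥ 16d² makes its term at most 2^{-(d-1)}. For d = 2 four trivial terms suffice.

The reproducing formula comes from integration by parts against a Gaussian, which relates the
spherical means of p and Δp. Applied to a harmonic polynomial times a power of ⟨e, x⟩, it shows that
lower powers are orthogonal and that the k-th power evaluates at e up to a constant
(`exists_mean_mul_linForm_pow`). An orthonormal basis of H_k fixes the constant for Z_e
(`finrank_mul_ip_zonalFun`).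

Part (b) takes c_{d,k} proportional to 2^{-d/2}‖f_k‖₂/‖f‖₂ and uses Bessel's inequality. -/

noncomputable section
namespace SphHarm

/-! ### Gaussian integrals and the spherical mean of a Laplacian. -/

variable {𝕜 : Type*} [RCLike 𝕜] {d : ℕ}

/-- In polar coordinates, a product of an angular and a radial function integrates to the product
of the integrals. -/
theorem integrable_and_integral_of_polar (hd : 0 < d) (u : C(Sph d, 𝕜)) (v : ℝ → 𝕜)
    (hv : IntegrableOn (fun r : ℝ => r ^ (d - 1) • v r) (Set.Ioi 0)) (f : Eucl d → 𝕜)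
    (hf : ∀ (y : Sph d) (r : ℝ), 0 < r → f (r • (y : Eucl d)) = u y * v r) :
    Integrable f ∧ ∫ x, f x = (∫ y, u y ∂(volume : Measure (Eucl d)).toSphere) *
      ∫ r in Set.Ioi (0 : ℝ), r ^ (d - 1) • v r := by
  have hdim : Module.finrank ℝ (Eucl d) = d := by simp
  have : Nontrivial (Eucl d) := Module.nontrivial_of_finrank_pos (R := ℝ) (by rw [hdim]; exact hd)
  have mp := (volume : Measure (Eucl d)).measurePreserving_homeomorphUnitSphereProd
  have emb := (homeomorphUnitSphereProd (Eucl d)).measurableEmbedding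
  rw [hdim] at mp
  let g : Sph d × Set.Ioi (0 : ℝ) → 𝕜 := fun p => u p.1 * v p.2
  have hg : ∀ x : ({(0 : Eucl d)}ᶜ : Set (Eucl d)),
      g (homeomorphUnitSphereProd (Eucl d) x) = f x := fun x => by
    have h := hf (homeomorphUnitSphereProd (Eucl d) x).1 (homeomorphUnitSphereProd (Eucl d) x).2
      (homeomorphUnitSphereProd (Eucl d) x).2.2
    rw [← homeomorphUnitSphereProd_symm_apply_coe, Homeomorph.symm_apply_apply] at h
    exact h.symm
  have hv' : Integrable (fun r : Set.Ioi (0 : ℝ) => v r) (Measure.volumeIoiPow (d - 1)) := by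
    rw [integrableOn_iff_comap_subtypeVal measurableSet_Ioi] at hv
    rw [Measure.volumeIoiPow, integrable_withDensity_iff_integrable_smul' (by fun_prop) (by simp)]
    refine hv.congr (.of_forall fun r => ?_)
    have : 0 < r.1 := r.2
    simp [ENNReal.toReal_ofReal (pow_nonneg this.le _)]
  have hvi : ∫ r : Set.Ioi (0 : ℝ), v r ∂(Measure.volumeIoiPow (d - 1)) =
      ∫ r in Set.Ioi (0 : ℝ), r ^ (d - 1) • v r := by
    simp only [Measure.volumeIoiPow, ENNReal.ofReal]
    rw [integral_withDensity_eq_integral_smul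
      (measurable_subtype_coe.pow_const _).real_toNNReal,
      integral_subtype_comap measurableSet_Ioi fun a => Real.toNNReal (a ^ (d - 1)) • v a]
    refine setIntegral_congr_fun measurableSet_Ioi fun x hx => ?_
    simp only [NNReal.smul_def]
    rw [Real.coe_toNNReal _ (pow_nonneg (le_of_lt hx) _)]
  have hu : Integrable u (volume : Measure (Eucl d)).toSphere :=
    u.continuous.integrable_of_hasCompactSupport (HasCompactSupport.of_compactSpace _)
  have hgi : Integrable g ((volume : Measure (Eucl d)).toSphere.prod
      (Measure.volumeIoiPow (d - 1))) := hu.mul_prod hv'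
  constructor
  · have := (mp.integrable_comp_emb emb (g := g)).2 hgi
    rw [← integrableOn_univ, ← Set.compl_union_self {(0 : Eucl d)}, integrableOn_union]
    refine ⟨?_, ?_⟩
    · rw [integrableOn_iff_comap_subtypeVal (by measurability)]
      exact this.congr (.of_forall hg)
    · exact integrableOn_singleton (by simp) (by simp)
  · calc ∫ x, f x = ∫ x : ({(0)}ᶜ : Set (Eucl d)), f x ∂((volume : Measure (Eucl d)).comap Subtype.val) := by
          rw [integral_subtype_comap (measurableSet_singleton _).compl f,
            restrict_compl_singleton]
      _ = ∫ x, g x ∂(volume : Measure (Eucl d)).toSphere.prod (.volumeIoiPow (d - 1)) := by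
          rw [← mp.integral_comp emb g]
          exact integral_congr_ae (.of_forall fun x => (hg x).symm)
      _ = _ := by
          rw [← hvi]
          exact integral_prod_mul (fun y => u y) (fun r : Set.Ioi (0 : ℝ) => v r)

/-- The half-line Gaussian moment of order `a`. -/
def gaussMoment (a : ℕ) : ℝ := ∫ r in Set.Ioi (0 : ℝ), r ^ a * Real.exp (-(r ^ 2 / 2))

theorem integrableOn_gaussMoment (a : ℕ) :
    IntegrableOn (fun r : ℝ => r ^ a * Real.exp (-(r ^ 2 / 2))) (Set.Ioi 0) := by
  have h := integrableOn_rpow_mul_exp_neg_mul_sq (b := 1 / 2) (by norm_num) (s := a)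
    (by have : (0 : ℝ) ≤ a := a.cast_nonneg
        linarith)
  refine h.congr_fun (fun r hr => ?_) measurableSet_Ioi
  simp only [Real.rpow_natCast]
  ring_nf

theorem gaussMoment_eq (a : ℕ) :
    gaussMoment a = (1 / 2 : ℝ) ^ (-((a : ℝ) + 1) / 2) * (1 / 2) * Real.Gamma (((a : ℝ) + 1) / 2) := by
  have ha : (0 : ℝ) ≤ a := a.cast_nonneg
  rw [← integral_rpow_mul_exp_neg_mul_rpow (p := 2) (q := a) (b := 1 / 2) (by norm_num)
    (by linarith) (by norm_num)]
  refine setIntegral_congr_fun measurableSet_Ioi fun r hr => ?_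
  simp only [Real.rpow_natCast, Real.rpow_ofNat]
  ring_nf

theorem gaussMoment_pos (a : ℕ) : 0 < gaussMoment a := by
  rw [gaussMoment_eq]
  have : (0 : ℝ) < ((a : ℝ) + 1) / 2 := by positivity
  have := Real.Gamma_pos_of_pos this
  positivity

theorem gaussMoment_add_two (a : ℕ) : gaussMoment (a + 2) = (a + 1) * gaussMoment a := by
  rw [gaussMoment_eq, gaussMoment_eq]
  have h1 : (((a + 2 : ℕ) : ℝ) + 1) / 2 = ((a : ℝ) + 1) / 2 + 1 := by push_cast; ring
  have h2 : -(((a + 2 : ℕ) : ℝ) + 1) / 2 = -((a : ℝ) + 1) / 2 + (-1) := by push_cast; ring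
  rw [h1, h2, Real.Gamma_add_one (by positivity), Real.rpow_add (by norm_num), Real.rpow_neg_one]
  norm_num
  ring

/-- Evaluation of a polynomial at a point of Euclidean space. -/
def ev (p : MvPolynomial (Fin d) 𝕜) (x : Eucl d) : 𝕜 := MvPolynomial.eval (fun i => (x i : 𝕜)) p

theorem ev_smul {m : ℕ} {p : MvPolynomial (Fin d) 𝕜} (hp : p.IsHomogeneous m) (r : ℝ)
    (x : Eucl d) : ev p (r • x) = (r : 𝕜) ^ m * ev p x := by
  simp only [ev, MvPolynomial.eval_eq', Finset.mul_sum]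
  refine Finset.sum_congr rfl fun s hs => ?_
  have hm := hp (MvPolynomial.mem_support_iff.1 hs)
  have hm' : ∑ i, s i = m := by
    rw [← hm, ← Finsupp.degree_eq_sum, Finsupp.degree_eq_weight_one]
    rfl
  rw [← hm', ← Finset.prod_pow_eq_pow_sum]
  simp only [PiLp.smul_apply, smul_eq_mul, map_mul, mul_pow, Finset.prod_mul_distrib]
  ring

theorem restr_apply (p : MvPolynomial (Fin d) 𝕜) (x : Sph d) : restr 𝕜 d p x = ev p x := rfl

theorem ev_add (p q : MvPolynomial (Fin d) 𝕜) : ev (p + q) = fun x => ev p x + ev q x := by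
  ext; simp [ev]

theorem ev_mul (p q : MvPolynomial (Fin d) 𝕜) : ev (p * q) = fun x => ev p x * ev q x := by
  ext; simp [ev]

/-- The coordinate function as a real-linear map into the scalars. -/
def coordCLM (𝕜 : Type*) [RCLike 𝕜] (i : Fin d) : Eucl d →L[ℝ] 𝕜 :=
  RCLike.ofRealCLM.comp (EuclideanSpace.proj (𝕜 := ℝ) i)

theorem coordCLM_apply (i : Fin d) (v : Eucl d) : coordCLM 𝕜 i v = (v i : 𝕜) := rfl

theorem hasFDerivAt_ev (p : MvPolynomial (Fin d) 𝕜) (x : Eucl d) :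
    HasFDerivAt (ev p) (∑ i, ev (MvPolynomial.pderiv i p) x • coordCLM 𝕜 i) x := by
  induction p using MvPolynomial.induction_on with
  | C a =>
    have : (ev (MvPolynomial.C a) : Eucl d → 𝕜) = fun _ => a := by ext; simp [ev]
    rw [this]
    refine (hasFDerivAt_const a x).congr_fderiv (ContinuousLinearMap.ext fun v => ?_)
    simp [ev]
  | add p q hp hq =>
    rw [ev_add]
    refine (hp.add hq).congr_fderiv (ContinuousLinearMap.ext fun v => ?_)
    simp [ev_add, add_mul, Finset.sum_add_distrib]
  | mul_X p j hp =>
    have hX : (ev (MvPolynomial.X j) : Eucl d → 𝕜) = coordCLM 𝕜 j := by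
      ext; simp [ev, coordCLM_apply]
    rw [ev_mul, hX]
    refine (hp.mul (coordCLM 𝕜 j).hasFDerivAt).congr_fderiv (ContinuousLinearMap.ext fun v => ?_)
    have h1 : ∀ i, ev (Pi.single (M := fun _ => MvPolynomial (Fin d) 𝕜) i 1 j) x * coordCLM 𝕜 i v =
        if i = j then coordCLM 𝕜 j v else 0 := fun i => by
      rcases eq_or_ne i j with rfl | h
      · simp [ev]
      · simp [ev, h]
    simp [MvPolynomial.pderiv_X, ev_add, ev_mul, add_mul, Finset.sum_add_distrib, hX,
      mul_assoc, h1, Finset.mul_sum]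
/-- The Gaussian weight. -/
def gauss (𝕜 : Type*) [RCLike 𝕜] (x : Eucl d) : 𝕜 := ((Real.exp (-(‖x‖ ^ 2 / 2)) : ℝ) : 𝕜)

theorem hasFDerivAt_gauss (x : Eucl d) :
    HasFDerivAt (gauss 𝕜) (∑ i, (-gauss 𝕜 x * (x i : 𝕜)) • coordCLM 𝕜 i) x := by
  have h := ((((hasStrictFDerivAt_norm_sq x).hasFDerivAt).mul_const (2⁻¹ : ℝ)).neg.exp)
  have h' := (RCLike.ofRealCLM (K := 𝕜)).hasFDerivAt.comp x h
  refine (h'.congr_fderiv (ContinuousLinearMap.ext fun v => ?_)).congr_of_eventuallyEq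
    (.of_forall fun y => ?_)
  · simp [gauss, coordCLM_apply, PiLp.inner_apply, Finset.mul_sum, div_eq_mul_inv]
    rw [RCLike.real_smul_eq_coe_mul, RCLike.real_smul_eq_coe_mul, Finset.mul_sum, Finset.mul_sum]
    refine Finset.sum_congr rfl fun i _ => ?_
    simp only [RCLike.algebraMap_eq_ofReal]
    push_cast
    ring
  · simp [gauss, div_eq_mul_inv]

/-- The integral over the sphere, with respect to the unnormalized surface measure. -/
def surf (p : MvPolynomial (Fin d) 𝕜) : 𝕜 :=
  ∫ y, restr 𝕜 d p y ∂(volume : Measure (Eucl d)).toSphere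

/-- Homogeneity separates the radial variable. Surface integrals thus become Gaussian integrals, for
which integration by parts has no boundary terms. -/
theorem ev_mul_gauss (hd : 0 < d) {m : ℕ} {p : MvPolynomial (Fin d) 𝕜} (hp : p.IsHomogeneous m) :
    Integrable (fun x => ev p x * gauss 𝕜 x) ∧
      ∫ x, ev p x * gauss 𝕜 x = surf p * (gaussMoment (m + (d - 1)) : 𝕜) := by
  have h : ∀ r : ℝ, (r ^ (d - 1) • ((r : 𝕜) ^ m * ((Real.exp (-(r ^ 2 / 2)) : ℝ) : 𝕜)) : 𝕜) =
      ((r ^ (m + (d - 1)) * Real.exp (-(r ^ 2 / 2)) : ℝ) : 𝕜) := fun r => by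
    rw [RCLike.real_smul_eq_coe_mul]
    push_cast
    ring
  have := integrable_and_integral_of_polar hd (restr 𝕜 d p)
    (fun r => (r : 𝕜) ^ m * ((Real.exp (-(r ^ 2 / 2)) : ℝ) : 𝕜)) (by
      simp only [h]
      exact (integrableOn_gaussMoment (m + (d - 1))).ofReal) (fun x => ev p x * gauss 𝕜 x) (by
      intro y r hr
      have hy : ‖(y : Eucl d)‖ = 1 := mem_sphere_zero_iff_norm.1 y.2
      simp only [gauss, ev_smul hp, restr_apply, norm_smul, hy, Real.norm_eq_abs, mul_one, sq_abs]
      ring)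
  refine ⟨this.1, this.2.trans ?_⟩
  simp only [h]
  rw [integral_ofReal]
  rfl

theorem integral_pderiv_mul_gauss (hd : 0 < d) {m : ℕ} {q : MvPolynomial (Fin d) 𝕜}
    (hq : q.IsHomogeneous m) (i : Fin d) :
    ∫ x, ev (MvPolynomial.pderiv i q) x * gauss 𝕜 x =
      ∫ x, ev (MvPolynomial.X i * q) x * gauss 𝕜 x := by
  classical
  let e : Eucl d := EuclideanSpace.single i 1
  have h1 : ∀ x, fderiv ℝ (ev q) x e = ev (MvPolynomial.pderiv i q) x := fun x => by
    simp [(hasFDerivAt_ev q x).fderiv, coordCLM_apply, e, PiLp.single_apply]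
  have h2 : ∀ x, ev q x * fderiv ℝ (gauss 𝕜) x e =
      -(ev (MvPolynomial.X i * q) x * gauss 𝕜 x) := fun x => by
    have : ev (MvPolynomial.X i) x = (x i : 𝕜) := by simp [ev]
    simp [(hasFDerivAt_gauss x).fderiv, coordCLM_apply, e, PiLp.single_apply, ev_mul, this]
    ring
  have := integral_mul_fderiv_eq_neg_fderiv_mul_of_integrable (μ := (volume : Measure (Eucl d)))
    (f := ev q) (g := gauss 𝕜) (v := e)
    (by simpa only [h1] using (ev_mul_gauss hd hq.pderiv).1)
    (by simpa only [h2] using (ev_mul_gauss hd ((MvPolynomial.isHomogeneous_X 𝕜 i).mul hq)).1.fun_neg)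
    (ev_mul_gauss hd hq).1 (fun x _ => (hasFDerivAt_ev q x).differentiableAt)
    (fun x _ => (hasFDerivAt_gauss x).differentiableAt)
  simp only [h1, h2, integral_neg, neg_inj] at this
  exact this.symm

theorem lap_apply (p : MvPolynomial (Fin d) 𝕜) :
    lap 𝕜 d p = ∑ i, MvPolynomial.pderiv i (MvPolynomial.pderiv i p) := by
  simp [lap]

theorem isHomogeneous_lap {m : ℕ} {p : MvPolynomial (Fin d) 𝕜} (hp : p.IsHomogeneous m) :
    (lap 𝕜 d p).IsHomogeneous (m - 1 - 1) := by
  rw [lap_apply]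
  exact MvPolynomial.IsHomogeneous.sum _ _ _ fun i _ => hp.pderiv.pderiv

/-- Integrating each second derivative by parts turns Δp into ∑ x_i ∂_i p, which is m p by Euler's
identity. -/
theorem surf_lap_mul (hd : 0 < d) {m : ℕ} {p : MvPolynomial (Fin d) 𝕜} (hp : p.IsHomogeneous m) :
    surf (lap 𝕜 d p) * (gaussMoment (m - 1 - 1 + (d - 1)) : 𝕜) =
      m * (surf p * (gaussMoment (m + (d - 1)) : 𝕜)) := by
  rw [← (ev_mul_gauss hd (isHomogeneous_lap hp)).2, ← (ev_mul_gauss hd hp).2, ← integral_const_mul]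
  have h1 : ∀ x, ev (lap 𝕜 d p) x * gauss 𝕜 x =
      ∑ i, ev (MvPolynomial.pderiv i (MvPolynomial.pderiv i p)) x * gauss 𝕜 x := fun x => by
    simp [lap_apply, ev, Finset.sum_mul]
  have h2 : ∀ x, (m : 𝕜) * (ev p x * gauss 𝕜 x) =
      ∑ i, ev (MvPolynomial.X i * MvPolynomial.pderiv i p) x * gauss 𝕜 x := fun x => by
    rw [← Finset.sum_mul, ← mul_assoc]
    congr 1
    have := congrArg (fun q => ev q x) hp.sum_X_mul_pderiv
    simpa [ev] using this.symm
  simp only [h1, h2]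
  rw [integral_finsetSum _ fun i _ => (ev_mul_gauss hd hp.pderiv.pderiv).1, integral_finsetSum _
    fun i _ => (ev_mul_gauss hd ((MvPolynomial.isHomogeneous_X 𝕜 i).mul hp.pderiv)).1]
  exact Finset.sum_congr rfl fun i _ => integral_pderiv_mul_gauss hd hp.pderiv i

theorem surf_lap (hd : 2 ≤ d) {m : ℕ} {p : MvPolynomial (Fin d) 𝕜} (hp : p.IsHomogeneous m) :
    surf (lap 𝕜 d p) = m * (m + d - 2) * surf p := by
  have h := surf_lap_mul (by omega) hp
  have hpos : ∀ a, (gaussMoment a : 𝕜) ≠ 0 := fun a =>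
    RCLike.ofReal_ne_zero.2 (gaussMoment_pos a).ne'
  -- For m ≤ 1 the degree `m - 1 - 1` is truncated and the moment recursion does not apply; from m =
  -- 2 on, the ratio of the two moments is the factor m + d - 2.
  rcases m with _ | _ | m
  · simpa [hpos] using h
  · have hl : lap 𝕜 d p = 0 := by
      rw [lap_apply]
      refine Finset.sum_eq_zero fun i _ => ?_
      have := hp.pderiv (i := i)
      rw [Nat.add_sub_cancel, ← MvPolynomial.totalDegree_zero_iff_isHomogeneous,
        MvPolynomial.totalDegree_eq_zero_iff_eq_C] at this
      rw [this, MvPolynomial.pderiv_C]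
    rw [hl] at h ⊢
    have : surf p = 0 := by simpa [surf, hpos] using h
    rw [this, mul_zero]
    simp [surf]
  · have e : m + 1 + 1 + (d - 1) = m + (d - 1) + 2 := by omega
    simp only [Nat.add_sub_cancel] at h
    rw [e, gaussMoment_add_two] at h
    have hc : ((d - 1 : ℕ) : 𝕜) = d - 1 := by rw [Nat.cast_sub (by omega)]; simp
    apply mul_right_cancel₀ (hpos (m + (d - 1)))
    rw [h]
    push_cast
    rw [hc]
    ring

end SphHarm
end

/-! ### Pairing harmonic polynomials with powers of a linear form. -/

noncomputable section
namespace SphHarm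

-- The commutator of two derivations is a derivation, so it suffices that it kills the variables.
open MvPolynomial in
theorem pderiv_pderiv_comm {σ R : Type*} [CommRing R] (i j : σ) (p : MvPolynomial σ R) :
    pderiv i (pderiv j p) = pderiv j (pderiv i p) := by
  classical
  have h : ⁅(pderiv i : Derivation R (MvPolynomial σ R) (MvPolynomial σ R)),
      (pderiv j : Derivation R (MvPolynomial σ R) (MvPolynomial σ R))⁆ = 0 := by
    refine MvPolynomial.derivation_ext fun l => ?_
    have h1 : ∀ a b c : σ, pderiv a (pderiv b (X c : MvPolynomial σ R)) = 0 := fun a b c => by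
      rw [pderiv_X]
      rcases eq_or_ne b c with rfl | h
      · simp
      · rw [Pi.single_eq_of_ne h.symm, map_zero]
    rw [Derivation.commutator_apply, h1, h1, sub_zero, Derivation.zero_apply]
  have := DFunLike.congr_fun h p
  rwa [Derivation.commutator_apply, Derivation.zero_apply, sub_eq_zero] at this

variable {𝕜 : Type*} [RCLike 𝕜] {d : ℕ}

section Laplacian
open MvPolynomial

theorem lap_mul (p q : MvPolynomial (Fin d) 𝕜) :
    lap 𝕜 d (p * q) =
      lap 𝕜 d p * q + 2 * ∑ i, pderiv i p * pderiv i q + p * lap 𝕜 d q := by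
  simp only [lap_apply, pderiv_mul, map_add, Finset.sum_mul, Finset.mul_sum,
    ← Finset.sum_add_distrib]
  exact Finset.sum_congr rfl fun i _ => by ring

theorem lap_pow (p : MvPolynomial (Fin d) 𝕜) (a : ℕ) :
    lap 𝕜 d (p ^ a) = (a * (a - 1)) * p ^ (a - 2) * ∑ i, pderiv i p ^ 2 +
      a * p ^ (a - 1) * lap 𝕜 d p := by
  rcases a with _ | a
  · simp [lap_apply]
  · simp only [lap_apply, Finset.mul_sum, ← Finset.sum_add_distrib]
    refine Finset.sum_congr rfl fun i _ => ?_
    rw [pderiv_pow, pderiv_mul, pderiv_mul, pderiv_pow]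
    simp only [Nat.add_sub_cancel, Nat.cast_add, Nat.cast_one]
    rw [show ((a : MvPolynomial (Fin d) 𝕜) + 1) = ((a + 1 : ℕ) : MvPolynomial (Fin d) 𝕜) by simp,
      Derivation.map_natCast, show a + 1 - 2 = a - 1 by omega]
    push_cast
    ring

/-- The linear form `x ↦ ⟪e, x⟫` as a polynomial. -/
def linForm (𝕜 : Type*) [RCLike 𝕜] (e : Eucl d) : MvPolynomial (Fin d) 𝕜 :=
  ∑ i, C (e i : 𝕜) * X i

theorem isHomogeneous_linForm (e : Eucl d) : (linForm 𝕜 e).IsHomogeneous 1 :=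
  IsHomogeneous.sum _ _ _ fun i _ => by
    simpa using (isHomogeneous_C (Fin d) (e i : 𝕜)).mul (isHomogeneous_X 𝕜 i)

theorem pderiv_linForm (e : Eucl d) (i : Fin d) : pderiv i (linForm 𝕜 e) = C (e i : 𝕜) := by
  classical
  simp only [linForm, map_sum, pderiv_C_mul]
  rw [Finset.sum_eq_single i]
  · simp
  · intro j _ hj
    rw [pderiv_X_of_ne hj, mul_zero]
  · simp

theorem ev_linForm (e x : Eucl d) : ev (linForm 𝕜 e) x = ((inner ℝ e x : ℝ) : 𝕜) := by
  simp [ev, linForm, PiLp.inner_apply, mul_comm]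

theorem sum_C_sq {e : Eucl d} (he : ‖e‖ = 1) :
    ∑ i, (C (e i : 𝕜) : MvPolynomial (Fin d) 𝕜) ^ 2 = 1 := by
  have h : ∑ i, e i ^ 2 = 1 := by rw [← EuclideanSpace.real_norm_sq_eq, he, one_pow]
  have h2 : ∑ i, (e i : 𝕜) ^ 2 = 1 := by exact_mod_cast congrArg (RCLike.ofReal (K := 𝕜)) h
  rw [← map_one C, ← h2, map_sum]
  simp only [map_pow]

theorem lap_linForm_pow {e : Eucl d} (he : ‖e‖ = 1) (a : ℕ) :
    lap 𝕜 d (linForm 𝕜 e ^ a) = (a * (a - 1)) * linForm 𝕜 e ^ (a - 2) := by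
  rw [lap_pow, lap_apply]
  simp [pderiv_linForm, sum_C_sq he]

/-- The derivative of a polynomial in the direction `e`. -/
def dirDeriv (e : Eucl d) (p : MvPolynomial (Fin d) 𝕜) : MvPolynomial (Fin d) 𝕜 :=
  ∑ i, C (e i : 𝕜) * pderiv i p

theorem isHomogeneous_dirDeriv (e : Eucl d) {k : ℕ} {p : MvPolynomial (Fin d) 𝕜}
    (hp : p.IsHomogeneous k) : (dirDeriv e p).IsHomogeneous (k - 1) :=
  IsHomogeneous.sum _ _ _ fun i _ => by
    simpa using (isHomogeneous_C (Fin d) (e i : 𝕜)).mul hp.pderiv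

theorem lap_dirDeriv (e : Eucl d) {p : MvPolynomial (Fin d) 𝕜} (hp : lap 𝕜 d p = 0) :
    lap 𝕜 d (dirDeriv e p) = 0 := by
  have h : ∀ i, lap 𝕜 d (pderiv i p) = pderiv i (lap 𝕜 d p) := fun i => by
    simp only [lap_apply, map_sum]
    exact Finset.sum_congr rfl fun j _ => by
      rw [pderiv_pderiv_comm j i p, pderiv_pderiv_comm j i]
  simp only [dirDeriv, map_sum, C_mul', map_smul, h, hp, map_zero, smul_zero,
    Finset.sum_const_zero]

theorem ev_dirDeriv_self (e : Eucl d) {k : ℕ} {p : MvPolynomial (Fin d) 𝕜}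
    (hp : p.IsHomogeneous k) : ev (dirDeriv e p) e = k * ev p e := by
  have := congrArg (fun q => ev q e) hp.sum_X_mul_pderiv
  simpa [ev, dirDeriv] using this

theorem lap_mul_linForm_pow {e : Eucl d} (he : ‖e‖ = 1) {p : MvPolynomial (Fin d) 𝕜}
    (hp : lap 𝕜 d p = 0) (j : ℕ) :
    lap 𝕜 d (p * linForm 𝕜 e ^ j) = (2 * j : 𝕜) • (dirDeriv e p * linForm 𝕜 e ^ (j - 1)) +
      (j * (j - 1) : 𝕜) • (p * linForm 𝕜 e ^ (j - 2)) := by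
  rw [lap_mul, hp, lap_linForm_pow he]
  simp only [pderiv_pow, pderiv_linForm, dirDeriv, smul_eq_C_mul, map_mul, map_sub, map_natCast,
    map_one, map_ofNat, Finset.sum_mul, Finset.mul_sum, zero_mul, zero_add]
  congr 1
  · exact Finset.sum_congr rfl fun i _ => by ring
  · ring

end Laplacian

/-- The mean over the sphere of a polynomial. -/
def mean : MvPolynomial (Fin d) 𝕜 →ₗ[𝕜] 𝕜 where
  toFun p := ∫ x, restr 𝕜 d p x ∂(unif d)
  map_add' p q := by
    simp only [map_add, ContinuousMap.add_apply]
    exact integral_add ((restr 𝕜 d p).continuous.integrable_of_hasCompactSupport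
      (HasCompactSupport.of_compactSpace _)) ((restr 𝕜 d q).continuous.integrable_of_hasCompactSupport
      (HasCompactSupport.of_compactSpace _))
  map_smul' c p := by
    simp only [map_smul, ContinuousMap.smul_apply, RingHom.id_apply]
    exact integral_smul c _

theorem mean_apply (p : MvPolynomial (Fin d) 𝕜) : mean p = ∫ x, restr 𝕜 d p x ∂(unif d) := rfl

theorem mean_lap (hd : 2 ≤ d) {m : ℕ} {p : MvPolynomial (Fin d) 𝕜} (hp : p.IsHomogeneous m) :
    mean (lap 𝕜 d p) = m * (m + d - 2) * mean p := by
  have h : ∀ q : MvPolynomial (Fin d) 𝕜, mean q =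
      (((volume : Measure (Eucl d)).toSphere Set.univ)⁻¹).toReal • surf q := fun q => by
    rw [mean_apply, unif, integral_smul_measure]
    rfl
  rw [h, h, surf_lap hd hp, mul_smul_comm]

/-- Since `dirDeriv e p` is again harmonic, this recursion never leaves the class of harmonic
polynomials times powers of the linear form; it drives the next two inductions. -/
theorem mean_mul_linForm_pow (hd : 2 ≤ d) {k : ℕ} {p : MvPolynomial (Fin d) 𝕜}
    (hp : p.IsHomogeneous k) (hl : lap 𝕜 d p = 0) {e : Eucl d} (he : ‖e‖ = 1) (j : ℕ) :
    ((k + j) * (k + j + d - 2) : 𝕜) * mean (p * linForm 𝕜 e ^ j) =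
      2 * j * mean (dirDeriv e p * linForm 𝕜 e ^ (j - 1)) +
        j * (j - 1) * mean (p * linForm 𝕜 e ^ (j - 2)) := by
  have h := mean_lap hd (hp.mul ((isHomogeneous_linForm e).pow j))
  rw [lap_mul_linForm_pow he hl, map_add, map_smul, map_smul, smul_eq_mul, smul_eq_mul] at h
  rw [h]
  push_cast
  ring

theorem recursion_coeff_ne_zero (hd : 2 ≤ d) {m : ℕ} (hm : 0 < m) :
    ((m : 𝕜) * (m + d - 2)) ≠ 0 := by
  have h1 : ((m : 𝕜) + d - 2) = ((m + (d - 2) : ℕ) : 𝕜) := by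
    rw [Nat.cast_add, Nat.cast_sub hd]
    push_cast
    ring
  rw [h1]
  exact mul_ne_zero (Nat.cast_ne_zero.2 hm.ne') (Nat.cast_ne_zero.2 (by omega))

/-- Harmonic polynomials are orthogonal to lower powers of linear forms. -/
theorem mean_mul_linForm_pow_of_lt (hd : 2 ≤ d) {e : Eucl d} (he : ‖e‖ = 1) (j : ℕ) :
    ∀ {k : ℕ} {p : MvPolynomial (Fin d) 𝕜}, p.IsHomogeneous k → lap 𝕜 d p = 0 → j < k →
      mean (p * linForm 𝕜 e ^ j) = 0 := by
  induction j using Nat.strong_induction_on with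
  | _ j ih =>
    intro k p hp hl hjk
    have h := mean_mul_linForm_pow hd hp hl he j
    -- Truncated exponents are harmless: for j = 0 the factor j vanishes, and otherwise both
    -- exponents are smaller than j and still below the degree of the harmonic factor.
    have h1 : (j : 𝕜) * mean (dirDeriv e p * linForm 𝕜 e ^ (j - 1)) = 0 := by
      rcases Nat.eq_zero_or_pos j with rfl | hj
      · simp
      · rw [ih (j - 1) (by omega) (isHomogeneous_dirDeriv e hp) (lap_dirDeriv e hl) (by omega),
          mul_zero]
    have h2 : (j : 𝕜) * mean (p * linForm 𝕜 e ^ (j - 2)) = 0 := by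
      rcases Nat.eq_zero_or_pos j with rfl | hj
      · simp
      · rw [ih (j - 2) (by omega) hp hl (by omega), mul_zero]
    have h3 : ((k + j) * (k + j + d - 2) : 𝕜) * mean (p * linForm 𝕜 e ^ j) = 0 := by
      rw [h]
      linear_combination 2 * h1 + (j - 1 : 𝕜) * h2
    have := recursion_coeff_ne_zero (𝕜 := 𝕜) hd (m := k + j) (by omega)
    push_cast at this
    exact (mul_eq_zero.1 h3).resolve_left this

/-- Pairing a harmonic polynomial of degree `k` with the `k`-th power of a linear form evaluates it,
up to a constant. -/
theorem exists_mean_mul_linForm_pow (hd : 2 ≤ d) (k : ℕ) :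
    ∃ c : 𝕜, ∀ (e : Eucl d), ‖e‖ = 1 → ∀ p : MvPolynomial (Fin d) 𝕜, p.IsHomogeneous k →
      lap 𝕜 d p = 0 → mean (p * linForm 𝕜 e ^ k) = c * ev p e := by
  induction k with
  | zero =>
    refine ⟨mean (1 : MvPolynomial (Fin d) 𝕜), fun e he p hp _ => ?_⟩
    rw [← MvPolynomial.totalDegree_zero_iff_isHomogeneous,
      MvPolynomial.totalDegree_eq_zero_iff_eq_C] at hp
    rw [hp, pow_zero, ← MvPolynomial.smul_eq_C_mul, map_smul]
    simp [ev, mul_comm]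
  | succ k ih =>
    obtain ⟨c, hc⟩ := ih
    -- One factor k + 1 is the exponent in the recursion, the other comes from Euler's identity for
    -- the derivative along e at e. The remaining mean vanishes by orthogonality to lower powers.
    refine ⟨c * (2 * (k + 1) * (k + 1)) / (((k + 1 + (k + 1) : ℕ) : 𝕜) *
      ((k + 1 + (k + 1) : ℕ) + d - 2)), fun e he p hp hl => ?_⟩
    have h := mean_mul_linForm_pow hd hp hl he (k + 1)
    have h1 := hc e he _ (isHomogeneous_dirDeriv e hp) (lap_dirDeriv e hl)
    have h2 : mean (p * linForm 𝕜 e ^ (k + 1 - 2)) = 0 :=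
      mean_mul_linForm_pow_of_lt hd he _ hp hl (by omega)
    rw [ev_dirDeriv_self e hp] at h1
    rw [Nat.add_sub_cancel, h1, h2] at h
    have hne := recursion_coeff_ne_zero (𝕜 := 𝕜) hd (m := k + 1 + (k + 1)) (by omega)
    rw [div_mul_eq_mul_div, eq_div_iff hne]
    push_cast at h ⊢
    linear_combination h

/-! ### Zonal harmonics -/

/-- The even moments of a coordinate on the unit sphere in dimension `n`. -/
def evenMoment (n j : ℕ) : ℝ := ∏ i ∈ Finset.range j, ((2 * i + 1 : ℝ) / (n + 2 * i))

theorem evenMoment_succ {n : ℕ} (hn : 0 < n) (j : ℕ) :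
    evenMoment n (j + 1) * (n + 2 * j) = evenMoment n j * (2 * j + 1) := by
  have : (n + 2 * j : ℝ) ≠ 0 := by positivity
  rw [evenMoment, Finset.prod_range_succ, ← evenMoment, mul_assoc, div_mul_cancel₀ _ this]

/-- The coefficients of the zonal harmonic of degree `k` in dimension `n + 1`. -/
def zonalCoeff (n k j : ℕ) : ℝ := k.choose (2 * j) * (-1) ^ j * evenMoment n j

/-- With n = d - 1 this is exactly the cancellation of neighbouring terms in the Laplacian of
`zonalPoly`. -/
theorem zonalCoeff_succ {n : ℕ} (hn : 0 < n) (k j : ℕ) (hj : 2 * j ≤ k) :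
    zonalCoeff n k (j + 1) * (2 * (j + 1) * (2 * j + n)) =
      -(zonalCoeff n k j * ((k - 2 * j) * (k - 2 * j - 1))) := by
  have h1 : (k.choose (2 * j + 1) : ℝ) * (2 * j + 1) = k.choose (2 * j) * (k - 2 * j) := by
    have := Nat.choose_succ_right_eq k (2 * j)
    have h := congrArg (Nat.cast (R := ℝ)) this
    push_cast [Nat.cast_sub hj] at h
    exact h
  have h2 : (k.choose (2 * j + 2) : ℝ) * (2 * j + 2) =
      k.choose (2 * j + 1) * (k - 2 * j - 1) := by
    rcases Nat.lt_or_ge (2 * j) k with hlt | hge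
    · have := Nat.choose_succ_right_eq k (2 * j + 1)
      have h := congrArg (Nat.cast (R := ℝ)) this
      push_cast [Nat.cast_sub (show 2 * j + 1 ≤ k from hlt)] at h
      linear_combination h
    · rw [Nat.choose_eq_zero_of_lt (by omega), Nat.choose_eq_zero_of_lt (by omega)]
      simp
  have h3 := evenMoment_succ hn j
  simp only [zonalCoeff, show 2 * (j + 1) = 2 * j + 2 by ring, pow_succ]
  have h4 : (2 * j + 1 : ℝ) ≠ 0 := by positivity
  apply mul_right_cancel₀ h4
  linear_combination (-(-1) ^ j * evenMoment n (j + 1) * (2 * j + n) * (2 * j + 1)) * h2 -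
    (-1) ^ j * evenMoment n (j + 1) * (2 * j + n) * (k - 2 * j - 1) * h1 -
    (-1) ^ j * (k.choose (2 * j) : ℝ) * (k - 2 * j - 1) * (k - 2 * j) * h3

/-- The squared distance to the line spanned by `e`, as a polynomial. -/
def perpSq (𝕜 : Type*) [RCLike 𝕜] (e : Eucl d) : MvPolynomial (Fin d) 𝕜 :=
  ∑ i, MvPolynomial.X i ^ 2 - linForm 𝕜 e ^ 2

section
open MvPolynomial

theorem isHomogeneous_perpSq (e : Eucl d) : (perpSq 𝕜 e).IsHomogeneous 2 :=
  (IsHomogeneous.sum _ _ _ fun i _ => by simpa using (isHomogeneous_X 𝕜 i).pow 2).sub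
    (by simpa using (isHomogeneous_linForm e).pow 2)

theorem pderiv_perpSq (e : Eucl d) (i : Fin d) :
    pderiv i (perpSq 𝕜 e) = 2 * (X i - linForm 𝕜 e * C (e i : 𝕜)) := by
  classical
  simp only [perpSq, map_sub, map_sum, pderiv_pow, pderiv_linForm]
  rw [Finset.sum_eq_single i]
  · simp
    ring
  · intro j _ hj
    rw [pderiv_X_of_ne hj, mul_zero]
  · simp

theorem linForm_eq (e : Eucl d) : ∑ i, X (R := 𝕜) i * C (e i : 𝕜) = linForm 𝕜 e :=
  Finset.sum_congr rfl fun _ _ => mul_comm _ _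

theorem lap_perpSq {e : Eucl d} (he : ‖e‖ = 1) : lap 𝕜 d (perpSq 𝕜 e) = 2 * (d - 1) := by
  have h := sum_C_sq (𝕜 := 𝕜) he
  have h1 : ∀ i, pderiv i (2 * (X i - linForm 𝕜 e * C (e i : 𝕜))) =
      2 * (1 - C (e i : 𝕜) ^ 2) := fun i => by
    rw [pderiv_mul, map_sub, pderiv_mul, pderiv_linForm, pderiv_C, pderiv_X_self]
    rw [show (2 : MvPolynomial (Fin d) 𝕜) = C 2 from (map_ofNat C 2).symm, pderiv_C]
    ring
  simp only [lap_apply, pderiv_perpSq, h1, ← Finset.mul_sum, Finset.sum_sub_distrib, h]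
  simp

theorem sum_pderiv_perpSq_sq {e : Eucl d} (he : ‖e‖ = 1) :
    ∑ i, pderiv i (perpSq 𝕜 e) ^ 2 = 4 * perpSq 𝕜 e := by
  have h := sum_C_sq (𝕜 := 𝕜) he
  have h1 : ∀ i, pderiv i (perpSq 𝕜 e) ^ 2 = 4 * X i ^ 2 -
      8 * linForm 𝕜 e * (X i * C (e i : 𝕜)) + 4 * linForm 𝕜 e ^ 2 * C (e i : 𝕜) ^ 2 := fun i => by
    rw [pderiv_perpSq]
    ring
  simp only [h1, Finset.sum_add_distrib, Finset.sum_sub_distrib, ← Finset.mul_sum, h, linForm_eq]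
  rw [perpSq]
  ring

theorem sum_pderiv_linForm_mul_perpSq {e : Eucl d} (he : ‖e‖ = 1) :
    ∑ i, pderiv i (linForm 𝕜 e) * pderiv i (perpSq 𝕜 e) = 0 := by
  have h := sum_C_sq (𝕜 := 𝕜) he
  have h1 : ∀ i, pderiv i (linForm 𝕜 e) * pderiv i (perpSq 𝕜 e) =
      2 * (X i * C (e i : 𝕜)) - 2 * linForm 𝕜 e * C (e i : 𝕜) ^ 2 := fun i => by
    rw [pderiv_perpSq, pderiv_linForm]
    ring
  simp only [h1, Finset.sum_sub_distrib, ← Finset.mul_sum, h, linForm_eq]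
  ring

/-- The gradients of the linear form ℓ and of q = `perpSq` are orthogonal, |∇q|² = 4q and Δq is
constant, so the Laplacian acts within the span of the products ℓ^a q^b. -/
theorem lap_linForm_pow_mul_perpSq_pow {e : Eucl d} (he : ‖e‖ = 1) (a b : ℕ) :
    lap 𝕜 d (linForm 𝕜 e ^ a * perpSq 𝕜 e ^ b) =
      (a * (a - 1) : 𝕜) • (linForm 𝕜 e ^ (a - 2) * perpSq 𝕜 e ^ b) +
      (2 * b * (2 * b + d - 3) : 𝕜) • (linForm 𝕜 e ^ a * perpSq 𝕜 e ^ (b - 1)) := by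
  have h1 : ∑ i, pderiv i (linForm 𝕜 e ^ a) * pderiv i (perpSq 𝕜 e ^ b) = 0 := by
    have : ∀ i, pderiv i (linForm 𝕜 e ^ a) * pderiv i (perpSq 𝕜 e ^ b) =
        (a * linForm 𝕜 e ^ (a - 1) * (b * perpSq 𝕜 e ^ (b - 1))) *
          (pderiv i (linForm 𝕜 e) * pderiv i (perpSq 𝕜 e)) := fun i => by
      rw [pderiv_pow, pderiv_pow]
      ring
    simp only [this, ← Finset.mul_sum, sum_pderiv_linForm_mul_perpSq he, mul_zero]
  rw [lap_mul, h1, lap_linForm_pow he, lap_pow, lap_perpSq he, sum_pderiv_perpSq_sq he]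
  simp only [smul_eq_C_mul, map_mul, map_sub, map_add, map_natCast, map_one, map_ofNat]
  rcases b with _ | _ | b
  · simp
  · simp
    ring
  · simp only [Nat.add_sub_cancel, show b + 1 + 1 - 2 = b by omega]
    push_cast
    ring

/-- The zonal harmonic polynomial of degree `k` with pole `e`. -/
def zonalPoly (𝕜 : Type*) [RCLike 𝕜] (k : ℕ) (e : Eucl d) : MvPolynomial (Fin d) 𝕜 :=
  ∑ j ∈ Finset.range (k / 2 + 1),
    (zonalCoeff (d - 1) k j : 𝕜) • (linForm 𝕜 e ^ (k - 2 * j) * perpSq 𝕜 e ^ j)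

theorem isHomogeneous_zonalPoly (k : ℕ) (e : Eucl d) : (zonalPoly 𝕜 k e).IsHomogeneous k := by
  refine IsHomogeneous.sum _ _ _ fun j hj => ?_
  have hj' : 2 * j ≤ k := by
    have := Finset.mem_range.1 hj
    omega
  have h := ((isHomogeneous_linForm (𝕜 := 𝕜) e).pow (k - 2 * j)).mul
    ((isHomogeneous_perpSq e).pow j)
  rw [one_mul, Nat.sub_add_cancel hj'] at h
  exact (homogeneousSubmodule (Fin d) 𝕜 k).smul_mem _ h

theorem lap_zonalPoly (hd : 2 ≤ d) (k : ℕ) {e : Eucl d} (he : ‖e‖ = 1) :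
    lap 𝕜 d (zonalPoly 𝕜 k e) = 0 := by
  simp only [zonalPoly, map_sum, map_smul, lap_linForm_pow_mul_perpSq_pow he, smul_add,
    Finset.sum_add_distrib, smul_smul]
  -- Peeling the top term of one sum and the bottom term of the other aligns equal monomials. The
  -- top term drops out because its exponent a is 0 or 1, so a(a - 1) = 0; the bottom one has b = 0.
  rw [Finset.sum_range_succ, Finset.sum_range_succ' _ (k / 2)]
  have hlast : (((k - 2 * (k / 2) : ℕ) : 𝕜) * (((k - 2 * (k / 2) : ℕ) : 𝕜) - 1)) = 0 := by
    rcases Nat.mod_two_eq_zero_or_one k with h | h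
    · rw [show k - 2 * (k / 2) = 0 by omega]; simp
    · rw [show k - 2 * (k / 2) = 1 by omega]; simp
  rw [hlast]
  simp only [mul_zero, zero_smul, add_zero, Nat.cast_zero, zero_mul]
  rw [← Finset.sum_add_distrib]
  refine Finset.sum_eq_zero fun j hj => ?_
  have hj' : 2 * j + 2 ≤ k := by
    have := Finset.mem_range.1 hj
    omega
  rw [Nat.add_sub_cancel, show k - 2 * (j + 1) = k - 2 * j - 2 by omega, ← add_smul]
  have h := congrArg (RCLike.ofReal (K := 𝕜))
    (zonalCoeff_succ (n := d - 1) (by omega) k j (by omega))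
  push_cast [Nat.cast_sub (show 1 ≤ d by omega)] at h
  have : (zonalCoeff (d - 1) k j : 𝕜) * (((k - 2 * j : ℕ) : 𝕜) * (((k - 2 * j : ℕ) : 𝕜) - 1)) +
      (zonalCoeff (d - 1) k (j + 1) : 𝕜) *
        (2 * ((j + 1 : ℕ) : 𝕜) * (2 * ((j + 1 : ℕ) : 𝕜) + d - 3)) = 0 := by
    push_cast [Nat.cast_sub (show 2 * j ≤ k by omega)]
    linear_combination h
  rw [this, zero_smul]

end

/-- The zonal harmonic of degree `k` in dimension `n + 1`, as a function of the height. -/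
def zonal (n k : ℕ) : Polynomial ℝ :=
  ∑ j ∈ Finset.range (k / 2 + 1), Polynomial.C (zonalCoeff n k j) *
    (Polynomial.X ^ (k - 2 * j) * (1 - Polynomial.X ^ 2) ^ j)

theorem zonal_eval (n k : ℕ) (t : ℝ) : (zonal n k).eval t =
    ∑ j ∈ Finset.range (k / 2 + 1), zonalCoeff n k j * (t ^ (k - 2 * j) * (1 - t ^ 2) ^ j) := by
  simp [zonal, Polynomial.eval_finsetSum]

theorem natDegree_zonal (n k : ℕ) : (zonal n k).natDegree ≤ k := by
  refine Polynomial.natDegree_sum_le_of_forall_le _ _ fun j hj => ?_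
  have hj' : 2 * j ≤ k := by
    have := Finset.mem_range.1 hj
    omega
  have : k = 0 + ((k - 2 * j) + j * 2) := by omega
  conv_rhs => rw [this]
  refine Polynomial.natDegree_mul_le_of_le (by simp) (Polynomial.natDegree_mul_le_of_le (by simp)
    (Polynomial.natDegree_pow_le_of_le j ?_))
  compute_degree

theorem zonal_eval_one (n k : ℕ) : (zonal n k).eval 1 = 1 := by
  rw [zonal_eval, Finset.sum_eq_single 0]
  · simp [zonalCoeff, evenMoment]
  · intro j _ hj
    simp [hj]
  · simp

theorem restr_zonalPoly (k : ℕ) (e x : Sph d) :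
    restr 𝕜 d (zonalPoly 𝕜 k (e : Eucl d)) x =
      (((zonal (d - 1) k).eval (inner ℝ (e : Eucl d) (x : Eucl d)) : ℝ) : 𝕜) := by
  have hl := ev_linForm (𝕜 := 𝕜) (e : Eucl d) (x : Eucl d)
  have hq : ev (perpSq 𝕜 (e : Eucl d)) (x : Eucl d) =
      ((1 - (inner ℝ (e : Eucl d) (x : Eucl d)) ^ 2 : ℝ) : 𝕜) := by
    have hx : ∑ i, (x : Eucl d) i ^ 2 = 1 := by
      rw [← EuclideanSpace.real_norm_sq_eq, mem_sphere_zero_iff_norm.1 x.2, one_pow]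
    have hx' : ∑ i, ((x : Eucl d) i : 𝕜) ^ 2 = 1 := by
      exact_mod_cast congrArg (RCLike.ofReal (K := 𝕜)) hx
    simp only [perpSq, ev, map_sub, map_pow] at hl ⊢
    rw [hl]
    simp [hx']
  simp only [restr_apply, ev, zonalPoly, zonal_eval] at hl hq ⊢
  rw [RCLike.ofReal_sum, map_sum]
  refine Finset.sum_congr rfl fun j _ => ?_
  rw [MvPolynomial.smul_eval, map_mul, map_pow, map_pow, hl, hq]
  simp only [map_mul, map_pow, RCLike.algebraMap_eq_ofReal]

/-- The zonal harmonic of degree `k` with pole `e`, as a function on the sphere. -/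
def zonalFun (𝕜 : Type*) [RCLike 𝕜] (k : ℕ) (e : Sph d) : C(Sph d, 𝕜) :=
  restr 𝕜 d (zonalPoly 𝕜 k (e : Eucl d))

theorem norm_sph (e : Sph d) : ‖(e : Eucl d)‖ = 1 := mem_sphere_zero_iff_norm.1 e.2

theorem zonalFun_mem_harm (hd : 2 ≤ d) (k : ℕ) (e : Sph d) : zonalFun 𝕜 k e ∈ harm 𝕜 d k :=
  ⟨_, ⟨isHomogeneous_zonalPoly k _, lap_zonalPoly hd k (norm_sph e)⟩, rfl⟩

theorem zonalFun_apply (k : ℕ) (e x : Sph d) : zonalFun 𝕜 k e x =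
    (((zonal (d - 1) k).eval (inner ℝ (e : Eucl d) (x : Eucl d)) : ℝ) : 𝕜) :=
  restr_zonalPoly k e x

theorem ip_zonalFun_aux (k : ℕ) (p : MvPolynomial (Fin d) 𝕜) (e : Sph d) :
    ip (restr 𝕜 d p) (zonalFun 𝕜 k e) = ∑ i ∈ Finset.range (k + 1),
      ((zonal (d - 1) k).coeff i : 𝕜) * mean (p * linForm 𝕜 (e : Eucl d) ^ i) := by
  simp only [← smul_eq_mul (a := ((zonal (d - 1) k).coeff _ : 𝕜)), ← map_smul, ← map_sum]
  refine integral_congr_ae (.of_forall fun x => ?_)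
  have hl := ev_linForm (𝕜 := 𝕜) (e : Eucl d) (x : Eucl d)
  simp only [zonalFun_apply, RCLike.conj_ofReal, restr_apply, ev] at hl ⊢
  rw [Polynomial.eval_eq_sum_range' (Nat.lt_succ_of_le (natDegree_zonal _ _))]
  simp only [map_sum, MvPolynomial.smul_eval, map_mul, map_pow, hl, Finset.mul_sum]
  exact Finset.sum_congr rfl fun i _ => by ring

/-- Among the powers of the height in the zonal profile, only the k-th pairs nontrivially with H_k.
The constant does not depend on the pole, which is what allows its later computation by integrating
over poles. -/
theorem exists_ip_zonalFun (hd : 2 ≤ d) (k : ℕ) :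
    ∃ c : 𝕜, ∀ (e : Sph d), ∀ h ∈ harm 𝕜 d k, ip h (zonalFun 𝕜 k e) = c * h e := by
  obtain ⟨c, hc⟩ := exists_mean_mul_linForm_pow (𝕜 := 𝕜) hd k
  refine ⟨((zonal (d - 1) k).coeff k : 𝕜) * c, ?_⟩
  rintro e _ ⟨p, ⟨hp, hl⟩, rfl⟩
  rw [ip_zonalFun_aux, Finset.sum_range_succ, Finset.sum_eq_zero, hc e (norm_sph e) p hp hl,
    zero_add, restr_apply, mul_assoc]
  intro i hi
  rw [mean_mul_linForm_pow_of_lt hd (norm_sph e) i hp hl (Finset.mem_range.1 hi), mul_zero]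

theorem ip_zonalFun_of_lt (hd : 2 ≤ d) {k l : ℕ} (hlk : l < k) (e : Sph d) {h : C(Sph d, 𝕜)}
    (hh : h ∈ harm 𝕜 d k) : ip h (zonalFun 𝕜 l e) = 0 := by
  obtain ⟨p, ⟨hp, hl⟩, rfl⟩ := hh
  rw [ip_zonalFun_aux]
  refine Finset.sum_eq_zero fun i hi => ?_
  rw [mean_mul_linForm_pow_of_lt hd (norm_sph e) i hp hl
    (by have := Finset.mem_range.1 hi; omega), mul_zero]

end SphHarm
end

/-! ### Dimension bound and the reproducing constant. -/

noncomputable section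
namespace SphHarm

variable {𝕜 : Type*} [RCLike 𝕜] {d : ℕ}

theorem coeff_lap (p : MvPolynomial (Fin d) 𝕜) (m : Fin d →₀ ℕ) :
    MvPolynomial.coeff m (lap 𝕜 d p) = ∑ i, MvPolynomial.coeff (m + Finsupp.single i 2) p *
      ((m i + 1) * (m i + 2)) := by
  simp only [lap_apply, MvPolynomial.coeff_sum, MvPolynomial.coeff_pderiv]
  refine Finset.sum_congr rfl fun i _ => ?_
  rw [add_assoc, ← Finsupp.single_add]
  simp only [Finsupp.add_apply, Finsupp.single_eq_same]
  push_cast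
  ring

/-- A harmonic polynomial is determined by its coefficients of exponent at most one in the first
variable. -/
theorem eq_zero_of_lap_eq_zero {n : ℕ} {p : MvPolynomial (Fin (n + 1)) 𝕜}
    (hl : lap 𝕜 (n + 1) p = 0) (h : ∀ m : Fin (n + 1) →₀ ℕ, m 0 ≤ 1 → MvPolynomial.coeff m p = 0) :
    p = 0 := by
  suffices H : ∀ a, ∀ m : Fin (n + 1) →₀ ℕ, m 0 = a → MvPolynomial.coeff m p = 0 by
    ext m
    simpa using H _ m rfl
  intro a
  induction a using Nat.strong_induction_on with
  | _ a ih =>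
    intro m hm
    rcases Nat.lt_or_ge 1 a with ha | ha
    · obtain ⟨m', hm'⟩ : ∃ m', m = m' + Finsupp.single 0 2 :=
        ⟨m - Finsupp.single 0 2, (tsub_add_cancel_of_le (by
          rw [Finsupp.single_le_iff]; omega)).symm⟩
      have h0 : m' 0 + 2 = a := by rw [← hm, hm']; simp
      -- The coefficient of Δp at m' involves one coefficient with first exponent a; the others have
      -- first exponent a - 2 and vanish by induction.
      have hc := coeff_lap p m'
      rw [hl, Finset.sum_eq_single 0, ← hm', MvPolynomial.coeff_zero] at hc
      · refine (mul_eq_zero.1 hc.symm).resolve_right ?_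
        have : (((m' 0 + 1) * (m' 0 + 2) : ℕ) : 𝕜) ≠ 0 := Nat.cast_ne_zero.2 (by positivity)
        exact_mod_cast this
      · intro i _ hi
        rw [ih (m' 0) (by omega) _ (by simp [hi]), zero_mul]
      · simp
    · exact h m (by omega)

-- Recording the coefficients of exponent 0 and 1 in the first variable is injective on harmonic
-- polynomials; they are indexed by monomials of degree k and k - 1 in the other n variables. Only
-- this upper bound on the dimension is needed.
open MvPolynomial in
theorem finrank_harm_le_multichoose (n k : ℕ) (hk : 1 ≤ k) :
    Module.finrank 𝕜 (harm 𝕜 (n + 1) k) ≤ n.multichoose k + n.multichoose (k - 1) := by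
  let HP : Submodule 𝕜 (MvPolynomial (Fin (n + 1)) 𝕜) :=
    homogeneousSubmodule (Fin (n + 1)) 𝕜 k ⊓ LinearMap.ker (lap 𝕜 (n + 1))
  have h1 : FiniteDimensional 𝕜 (homogeneousSubmodule (Fin (n + 1)) 𝕜 k) :=
    Module.Finite.iff_fg.2 (homogeneousSubmodule_fg (Fin (n + 1)) 𝕜 k)
  have h2 : FiniteDimensional 𝕜 HP := Submodule.finiteDimensional_of_le inf_le_left
  let φ : MvPolynomial (Fin (n + 1)) 𝕜 →ₗ[𝕜]
      (Sym (Fin n) k → 𝕜) × (Sym (Fin n) (k - 1) → 𝕜) :=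
    LinearMap.prod
      (LinearMap.pi fun s => lcoeff 𝕜 (Finsupp.cons 0 (Multiset.toFinsupp (s : Multiset (Fin n)))))
      (LinearMap.pi fun s => lcoeff 𝕜 (Finsupp.cons 1 (Multiset.toFinsupp (s : Multiset (Fin n)))))
  have hinj : Function.Injective (φ ∘ₗ HP.subtype) := by
    rw [← LinearMap.ker_eq_bot, LinearMap.ker_eq_bot']
    rintro ⟨p, hp, hl⟩ h
    have hφ : φ p = 0 := h
    have key : ∀ (a b : ℕ), a + b = k → (∀ s : Sym (Fin n) b,
        coeff (Finsupp.cons a (Multiset.toFinsupp (s : Multiset (Fin n)))) p = 0) →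
        ∀ m : Fin (n + 1) →₀ ℕ, m 0 = a → coeff m p = 0 := by
      intro a b hab hs m hm
      by_contra hne
      have hdeg : m.degree = k := by
        rw [Finsupp.degree_eq_weight_one]
        exact hp hne
      have hm' : Finsupp.cons a m.tail = m := by rw [← hm, Finsupp.cons_tail]
      have htail : m.tail.degree = b := by
        rw [Finsupp.degree_eq_sum, Fin.sum_univ_succ] at hdeg
        rw [Finsupp.degree_eq_sum]
        simp only [Finsupp.tail_apply]
        omega
      have := hs ⟨Finsupp.toMultiset m.tail, by
        rw [Finsupp.card_toMultiset]; exact htail⟩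
      rw [Sym.coe_mk, Finsupp.toMultiset_toFinsupp, hm'] at this
      exact hne this
    have : p = 0 := by
      refine eq_zero_of_lap_eq_zero hl fun m hm => ?_
      rcases Nat.le_one_iff_eq_zero_or_eq_one.1 hm with h0 | h0
      · exact key 0 k (zero_add k) (fun s => congrFun (congrArg Prod.fst hφ) s) m h0
      · exact key 1 (k - 1) (by omega) (fun s => congrFun (congrArg Prod.snd hφ) s) m h0
    exact Subtype.ext this
  calc Module.finrank 𝕜 (harm 𝕜 (n + 1) k) ≤ Module.finrank 𝕜 HP := Submodule.finrank_map_le _ _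
    _ ≤ Module.finrank 𝕜 ((Sym (Fin n) k → 𝕜) × (Sym (Fin n) (k - 1) → 𝕜)) :=
      LinearMap.finrank_le_finrank_of_injective hinj
    _ = _ := by
      rw [Module.finrank_prod, Module.finrank_fintype_fun_eq_card,
        Module.finrank_fintype_fun_eq_card, Sym.card_sym_eq_multichoose,
        Sym.card_sym_eq_multichoose, Fintype.card_fin]

theorem N_eq_multichoose {n k : ℕ} (hn : 1 ≤ n) (hk : 1 ≤ k) :
    N k (n + 1) = (n.multichoose k + n.multichoose (k - 1) : ℕ) := by
  obtain ⟨n, rfl⟩ := Nat.exists_eq_add_of_le' hn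
  obtain ⟨k, rfl⟩ := Nat.exists_eq_add_of_le' hk
  have e1 : (n + 1).multichoose (k + 1) = (n + (k + 1)).choose n := by
    rw [Nat.multichoose_eq, show n + 1 + (k + 1) - 1 = n + (k + 1) by omega,
      Nat.choose_symm_add]
  have e2 : (n + 1).multichoose k = (n + k).choose n := by
    rw [Nat.multichoose_eq, show n + 1 + k - 1 = n + k by omega, Nat.choose_symm_add]
  rw [N, if_neg (by omega), Nat.add_sub_cancel, e1, e2, Nat.cast_add, Nat.cast_add_choose,
    Nat.cast_add_choose, show k + 1 + (n + 1 + 1) - 3 = n + k by omega,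
    show n + 1 + 1 - 2 = n by omega, show 2 * (k + 1) + (n + 1 + 1) - 2 = 2 * k + n + 2 by omega,
    show n + (k + 1) = n + k + 1 by omega, Nat.factorial_succ, Nat.factorial_succ]
  have h1 := Nat.factorial_pos n
  have h2 := Nat.factorial_pos k
  push_cast
  field_simp
  ring

theorem finrank_harm_le (hd : 2 ≤ d) {k : ℕ} (hk : 1 ≤ k) :
    (Module.finrank 𝕜 (harm 𝕜 d k) : ℝ) ≤ N k d := by
  obtain ⟨n, rfl⟩ := Nat.exists_eq_add_of_le' (show 1 ≤ d by omega)
  rw [N_eq_multichoose (by omega) hk]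
  exact_mod_cast finrank_harm_le_multichoose n k hk

theorem isProbabilityMeasure_unif (hd : 0 < d) : IsProbabilityMeasure (unif d) := by
  have hdim : Module.finrank ℝ (Eucl d) = d := by simp
  have : Nontrivial (Eucl d) := Module.nontrivial_of_finrank_pos (R := ℝ) (by rw [hdim]; exact hd)
  refine ⟨?_⟩
  rw [unif, Measure.smul_apply, smul_eq_mul]
  refine ENNReal.inv_mul_cancel ?_ (measure_ne_top _ _)
  exact Measure.measure_univ_ne_zero.2 (Measure.toSphere_ne_zero _)

theorem ip_conj_symm (f g : C(Sph d, 𝕜)) : conj (ip f g) = ip g f := by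
  rw [ip, ip, ← integral_conj]
  simp [mul_comm]

theorem ip_self (f : C(Sph d, 𝕜)) : ip f f = ((norm2 f ^ 2 : ℝ) : 𝕜) := by
  rw [norm2, Real.sq_sqrt (integral_nonneg fun x => by positivity), ip, ← integral_ofReal]
  refine integral_congr_ae (.of_forall fun x => ?_)
  simp [RCLike.mul_conj]

/-- The embedding of continuous functions into `L²`. -/
def embL2 (𝕜 : Type*) [RCLike 𝕜] (d : ℕ) : C(Sph d, 𝕜) →L[𝕜] Lp 𝕜 2 (unif d) :=
  ContinuousMap.toLp (E := 𝕜) 2 (unif d) 𝕜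

theorem embL2_injective : Function.Injective (embL2 𝕜 d) := ContinuousMap.toLp_injective (unif d)

theorem inner_embL2 (u v : C(Sph d, 𝕜)) : inner 𝕜 (embL2 𝕜 d v) (embL2 𝕜 d u) = ip u v := by
  simp only [embL2, ContinuousMap.inner_toLp, ip]

theorem norm_embL2 (u : C(Sph d, 𝕜)) : ‖embL2 𝕜 d u‖ = norm2 u := by
  have h := inner_self_eq_norm_sq_to_K (𝕜 := 𝕜) (embL2 𝕜 d u)
  rw [inner_embL2, ip_self] at h
  have h' : norm2 u ^ 2 = ‖embL2 𝕜 d u‖ ^ 2 := by exact_mod_cast h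
  exact ((sq_eq_sq₀ (Real.sqrt_nonneg _) (norm_nonneg _)).1 h').symm

theorem integral_norm_sq (f : C(Sph d, 𝕜)) : ∫ x, ‖f x‖ ^ 2 ∂(unif d) = norm2 f ^ 2 := by
  rw [norm2, Real.sq_sqrt (integral_nonneg fun x => by positivity)]

theorem exists_orthonormalBasis_harm (k : ℕ) :
    ∃ φ : Fin (Module.finrank 𝕜 (harm 𝕜 d k)) → C(Sph d, 𝕜),
      (∀ i, φ i ∈ harm 𝕜 d k) ∧ (∀ i, norm2 (φ i) = 1) ∧
      ∀ h ∈ harm 𝕜 d k, h = ∑ i, ip h (φ i) • φ i := by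
  let K : Submodule 𝕜 (Lp 𝕜 2 (unif d)) := (harm 𝕜 d k).map (embL2 𝕜 d).toLinearMap
  have hK : FiniteDimensional 𝕜 K := by unfold K; infer_instance
  have hrank : Module.finrank 𝕜 K = Module.finrank 𝕜 (harm 𝕜 d k) :=
    (Submodule.equivMapOfInjective (embL2 𝕜 d).toLinearMap embL2_injective _).finrank_eq.symm
  rw [← hrank]
  let b := stdOrthonormalBasis 𝕜 K
  choose φ hφ hφb using fun i => (b i).2
  replace hφb : ∀ i, embL2 𝕜 d (φ i) = b i := hφb
  refine ⟨φ, hφ, fun i => ?_, fun h hh => embL2_injective ?_⟩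
  · rw [← norm_embL2, hφb]
    exact b.orthonormal.1 i
  · have := congrArg K.subtype (b.sum_repr' ⟨embL2 𝕜 d h, h, hh, rfl⟩)
    simp only [map_sum, map_smul, Submodule.subtype_apply, Submodule.coe_inner] at this
    rw [← this, map_sum]
    refine Finset.sum_congr rfl fun i _ => ?_
    rw [map_smul, ← hφb, inner_embL2]

theorem zonalFun_self (k : ℕ) (e : Sph d) : zonalFun 𝕜 k e e = 1 := by
  rw [zonalFun_apply, real_inner_self_eq_norm_sq, norm_sph, one_pow, zonal_eval_one,
    RCLike.ofReal_one]

/-- The zonal harmonic with pole x is expanded in the basis and evaluated at x, where it equals 1;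
its coefficients are known up to c. -/
theorem eq_conj_mul_sum_norm_sq (hd : 2 ≤ d) (k : ℕ) {c : 𝕜}
    (hc : ∀ (e : Sph d), ∀ h ∈ harm 𝕜 d k, ip h (zonalFun 𝕜 k e) = c * h e) {D : ℕ}
    {φ : Fin D → C(Sph d, 𝕜)} (hφ : ∀ i, φ i ∈ harm 𝕜 d k)
    (hexp : ∀ h ∈ harm 𝕜 d k, h = ∑ i, ip h (φ i) • φ i) (x : Sph d) :
    (1 : 𝕜) = conj c * ∑ i, ((‖φ i x‖ ^ 2 : ℝ) : 𝕜) := by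
  have := congrArg (fun g : C(Sph d, 𝕜) => g x) (hexp _ (zonalFun_mem_harm hd k x))
  simp only [zonalFun_self, ContinuousMap.sum_apply, ContinuousMap.smul_apply] at this
  rw [this, Finset.mul_sum]
  refine Finset.sum_congr rfl fun i _ => ?_
  rw [← ip_conj_symm, hc x _ (hφ i), map_mul, smul_eq_mul, mul_assoc, RCLike.conj_mul]
  push_cast
  rfl

theorem integral_sum_norm_sq {D : ℕ} (φ : Fin D → C(Sph d, 𝕜)) (hone : ∀ i, norm2 (φ i) = 1) :
    ∫ x, ∑ i, ((‖φ i x‖ ^ 2 : ℝ) : 𝕜) ∂(unif d) = D := by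
  have hi : ∀ i ∈ Finset.univ, Integrable (fun x => ((‖φ i x‖ ^ 2 : ℝ) : 𝕜)) (unif d) :=
    fun i _ => by
      have hc : Continuous fun x => ‖φ i x‖ ^ 2 := (φ i).continuous.norm.pow 2
      exact (hc.integrable_of_hasCompactSupport (HasCompactSupport.of_compactSpace _)).ofReal
  rw [integral_finsetSum _ hi]
  have : ∀ i, ∫ x, ((‖φ i x‖ ^ 2 : ℝ) : 𝕜) ∂(unif d) = 1 := fun i => by
    rw [integral_ofReal, integral_norm_sq, hone, one_pow, RCLike.ofReal_one]
  simp only [this, Finset.sum_const, Finset.card_univ, Fintype.card_fin, nsmul_eq_mul, mul_one]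

/-- The zonal harmonics reproduce the values of spherical harmonics. -/
theorem finrank_mul_ip_zonalFun (hd : 2 ≤ d) (k : ℕ) (e : Sph d) {h : C(Sph d, 𝕜)}
    (hh : h ∈ harm 𝕜 d k) :
    (Module.finrank 𝕜 (harm 𝕜 d k) : 𝕜) * ip h (zonalFun 𝕜 k e) = h e := by
  obtain ⟨c, hc⟩ := exists_ip_zonalFun (𝕜 := 𝕜) hd k
  obtain ⟨φ, hφ, hone, hexp⟩ := exists_orthonormalBasis_harm (𝕜 := 𝕜) (d := d) k
  have hprob := isProbabilityMeasure_unif (d := d) (by omega)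
  -- Integrating over the pole gives 1 = conj c · D, since each basis function has norm one.
  have hsum := integral_congr_ae (μ := unif d)
    (.of_forall fun x => eq_conj_mul_sum_norm_sq hd k hc hφ hexp x)
  rw [integral_const_mul, integral_sum_norm_sq φ hone, integral_const, probReal_univ,
    one_smul] at hsum
  have h2 := congrArg conj hsum
  rw [map_one, map_mul, RCLike.conj_conj, map_natCast] at h2
  rw [hc e h hh, ← mul_assoc, mul_comm _ c, ← h2, one_mul]

end SphHarm
end

/-! ### Laplace's integral and the decay of zonal harmonics. -/

noncomputable section
namespace SphHarm

open Real

theorem re_add_mul_I_pow (k : ℕ) (t y : ℝ) : (((t : ℂ) + y * Complex.I) ^ k).re =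
    ∑ j ∈ Finset.range (k / 2 + 1), k.choose (2 * j) * (-1) ^ j * (t ^ (k - 2 * j) * (y ^ 2) ^ j) := by
  have heven : ∀ j, (((y : ℂ) * Complex.I) ^ (2 * j)) = (((-1) ^ j * (y ^ 2) ^ j : ℝ) : ℂ) :=
    fun j => by
      rw [pow_mul, mul_pow, Complex.I_sq]
      push_cast
      rw [mul_pow]
      ring
  let f : ℕ → ℝ := fun m =>
    (((y : ℂ) * Complex.I) ^ m * (t : ℂ) ^ (k - m) * (k.choose m : ℂ)).re
  have hf : ∀ j, f (2 * j) =
      k.choose (2 * j) * (-1) ^ j * (t ^ (k - 2 * j) * (y ^ 2) ^ j) := fun j => by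
    simp only [f]
    rw [heven, show ((((-1) ^ j * (y ^ 2) ^ j : ℝ) : ℂ) * (t : ℂ) ^ (k - 2 * j) *
      (k.choose (2 * j) : ℂ)) =
      ((k.choose (2 * j) * (-1) ^ j * (t ^ (k - 2 * j) * (y ^ 2) ^ j) : ℝ) : ℂ) by
        push_cast; ring, Complex.ofReal_re]
  have hodd : ∀ j, f (2 * j + 1) = 0 := fun j => by
    simp only [f]
    rw [pow_succ, heven, show ((((-1) ^ j * (y ^ 2) ^ j : ℝ) : ℂ) * ((y : ℂ) * Complex.I) *
      (t : ℂ) ^ (k - (2 * j + 1)) * (k.choose (2 * j + 1) : ℂ)) =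
      (((-1) ^ j * (y ^ 2) ^ j * y * t ^ (k - (2 * j + 1)) * k.choose (2 * j + 1) : ℝ) : ℂ) *
        Complex.I by push_cast; ring, Complex.re_ofReal_mul, Complex.I_re, mul_zero]
  rw [add_comm, add_pow, Complex.re_sum]
  simp only [← hf]
  rw [← Finset.sum_image (s := Finset.range (k / 2 + 1)) (g := fun j => 2 * j) (f := f)
    (fun a _ b _ h => by simpa using h)]
  symm
  refine Finset.sum_subset (fun m hm => ?_) fun m hm hm' => ?_
  · obtain ⟨j, hj, rfl⟩ := Finset.mem_image.1 hm
    have := Finset.mem_range.1 hj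
    exact Finset.mem_range.2 (by omega)
  · rcases Nat.even_or_odd' m with ⟨j, rfl | rfl⟩
    · refine absurd (Finset.mem_image.2 ⟨j, Finset.mem_range.2 ?_, rfl⟩) hm'
      have := Finset.mem_range.1 hm
      omega
    · exact hodd j

theorem abs_re_add_mul_I_pow_le (k : ℕ) (t y : ℝ) :
    |∑ j ∈ Finset.range (k / 2 + 1),
      k.choose (2 * j) * (-1) ^ j * (t ^ (k - 2 * j) * (y ^ 2) ^ j)| ≤ √(t ^ 2 + y ^ 2) ^ k := by
  rw [← re_add_mul_I_pow]
  refine (Complex.abs_re_le_norm _).trans ?_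
  rw [norm_pow, Complex.norm_add_mul_I]

/-- For d = 2 all even moments are 1 and the profile is the Chebyshev polynomial Re (t +
i√(1-t²))^k; the integral representation below starts only at n = 2. -/
theorem abs_zonal_one_le (k : ℕ) {t : ℝ} (ht : |t| ≤ 1) : |(zonal 1 k).eval t| ≤ 1 := by
  have h1 : 0 ≤ 1 - t ^ 2 := by nlinarith [abs_le.1 ht]
  have hm : ∀ j, evenMoment 1 j = 1 := fun j => Finset.prod_eq_one fun i _ => by
    rw [Nat.cast_one, add_comm]
    exact div_self (by positivity)
  have := abs_re_add_mul_I_pow_le k t √(1 - t ^ 2)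
  simpa [zonal_eval, zonalCoeff, hm, Real.sq_sqrt h1] using this

/-- The derivative of sin^{a+1} cos^{2j+1} integrates to zero. The resulting recursion is that of
`evenMoment (a + 2)`. -/
theorem integral_sin_pow_mul_cos_pow_succ (a j : ℕ) :
    (∫ x in (0)..π, sin x ^ a * cos x ^ (2 * (j + 1))) * (a + 2 + 2 * j) =
      (∫ x in (0)..π, sin x ^ a * cos x ^ (2 * j)) * (2 * j + 1) := by
  have hderiv : ∀ x, HasDerivAt (fun x => sin x ^ (a + 1) * cos x ^ (2 * j + 1))
      ((a + 2 + 2 * j) * (sin x ^ a * cos x ^ (2 * (j + 1))) -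
        (2 * j + 1) * (sin x ^ a * cos x ^ (2 * j))) x := fun x => by
    refine (((hasDerivAt_sin x).pow (a + 1)).mul ((hasDerivAt_cos x).pow (2 * j + 1))).congr_deriv ?_
    simp only [Nat.add_sub_cancel, Pi.pow_apply]
    push_cast
    have h := sin_sq x
    have e1 : cos x ^ (2 * (j + 1)) = cos x ^ (2 * j) * cos x ^ 2 := by ring
    have e2 : cos x ^ (2 * j + 1) = cos x ^ (2 * j) * cos x := by ring
    have e3 : sin x ^ (a + 1) = sin x ^ a * sin x := by ring
    rw [e1, e2, e3]
    linear_combination (-(2 * j + 1) * sin x ^ a * cos x ^ (2 * j)) * h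
  have hint : ∀ m, IntervalIntegrable (fun x => sin x ^ a * cos x ^ m) volume 0 π := fun m =>
    (by fun_prop : Continuous fun x => sin x ^ a * cos x ^ m).intervalIntegrable _ _
  have := intervalIntegral.integral_eq_sub_of_hasDerivAt (fun x _ => hderiv x)
    (((hint _).const_mul _).sub ((hint _).const_mul _))
  rw [intervalIntegral.integral_sub ((hint _).const_mul _) ((hint _).const_mul _), intervalIntegral.integral_const_mul,
    intervalIntegral.integral_const_mul] at this
  simp only [sin_pi, sin_zero, ne_eq, Nat.add_eq_zero_iff, one_ne_zero, and_false,
    not_false_eq_true, zero_pow, zero_mul, sub_zero] at this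
  linear_combination this

theorem evenMoment_mul_integral (a j : ℕ) :
    evenMoment (a + 2) j * ∫ x in (0)..π, sin x ^ a =
      ∫ x in (0)..π, sin x ^ a * cos x ^ (2 * j) := by
  induction j with
  | zero => simp [evenMoment]
  | succ j ih =>
    have h1 := evenMoment_succ (n := a + 2) (by omega) j
    have h2 := integral_sin_pow_mul_cos_pow_succ a j
    have h3 : (a + 2 + 2 * j : ℝ) ≠ 0 := by positivity
    apply mul_right_cancel₀ h3
    rw [h2, ← ih]
    push_cast at h1
    linear_combination (∫ x in (0)..π, sin x ^ a) * h1

/-- Laplace's integral, left unnormalized: replacing even moments by integrals of cos^{2j}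
reassembles the real part of (t + i√(1-t²) cos x)^k. -/
theorem zonal_mul_integral (a k : ℕ) (t : ℝ) (ht : |t| ≤ 1) :
    (zonal (a + 2) k).eval t * ∫ x in (0)..π, sin x ^ a =
      ∫ x in (0)..π, sin x ^ a * ∑ j ∈ Finset.range (k / 2 + 1),
        k.choose (2 * j) * (-1) ^ j * (t ^ (k - 2 * j) * ((√(1 - t ^ 2) * cos x) ^ 2) ^ j) := by
  have h1 : 0 ≤ 1 - t ^ 2 := by nlinarith [abs_le.1 ht]
  simp only [Finset.mul_sum]
  rw [intervalIntegral.integral_finsetSum fun j _ =>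
    (by fun_prop : Continuous _).intervalIntegrable _ _, zonal_eval, Finset.sum_mul]
  refine Finset.sum_congr rfl fun j _ => ?_
  rw [zonalCoeff, show (k.choose (2 * j) : ℝ) * (-1) ^ j * evenMoment (a + 2) j *
    (t ^ (k - 2 * j) * (1 - t ^ 2) ^ j) * ∫ x in (0)..π, sin x ^ a =
    (k.choose (2 * j) * (-1) ^ j * (t ^ (k - 2 * j) * (1 - t ^ 2) ^ j)) *
      (evenMoment (a + 2) j * ∫ x in (0)..π, sin x ^ a) by ring, evenMoment_mul_integral,
    ← intervalIntegral.integral_const_mul]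
  congr 1
  ext x
  rw [mul_pow (√_), Real.sq_sqrt h1, mul_pow (1 - t ^ 2), pow_mul (cos x)]
  ring

/-- The squared modulus of the base is 1 - (1-t²) sin² x, at most the exponential of -(1-t²) sin² x.
-/
theorem abs_zonal_mul_integral_le (a k : ℕ) (t : ℝ) (ht : |t| ≤ 1) :
    |(zonal (a + 2) k).eval t| * ∫ x in (0)..π, sin x ^ a ≤
      ∫ x in (0)..π, sin x ^ a * rexp (-(k * (1 - t ^ 2) / 2 * sin x ^ 2)) := by
  have h1 : 0 ≤ 1 - t ^ 2 := by nlinarith [abs_le.1 ht]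
  rw [← abs_of_pos (integral_sin_pow_pos a), ← abs_mul, zonal_mul_integral a k t ht,
    ← Real.norm_eq_abs]
  refine intervalIntegral.norm_integral_le_of_norm_le pi_pos.le (.of_forall fun x hx => ?_)
    ((by fun_prop : Continuous _).intervalIntegrable _ _)
  have hs : 0 ≤ sin x := sin_nonneg_of_nonneg_of_le_pi hx.1.le hx.2
  rw [Real.norm_eq_abs, abs_mul, abs_of_nonneg (pow_nonneg hs a)]
  refine mul_le_mul_of_nonneg_left ((abs_re_add_mul_I_pow_le k t _).trans ?_) (pow_nonneg hs a)
  have h2 : t ^ 2 + (√(1 - t ^ 2) * cos x) ^ 2 ≤ rexp (-((1 - t ^ 2) * sin x ^ 2 / 2)) ^ 2 := by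
    rw [mul_pow, Real.sq_sqrt h1, cos_sq', ← Real.exp_nat_mul]
    have := Real.add_one_le_exp (-((1 - t ^ 2) * sin x ^ 2))
    rw [show ((2 : ℕ) : ℝ) * -((1 - t ^ 2) * sin x ^ 2 / 2) = -((1 - t ^ 2) * sin x ^ 2) by
      push_cast; ring]
    linarith
  calc √(t ^ 2 + (√(1 - t ^ 2) * cos x) ^ 2) ^ k
      ≤ rexp (-((1 - t ^ 2) * sin x ^ 2 / 2)) ^ k := by
        gcongr
        exact Real.sqrt_le_iff.2 ⟨(Real.exp_pos _).le, h2⟩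
    _ = rexp (-(k * (1 - t ^ 2) / 2 * sin x ^ 2)) := by
        rw [← Real.exp_nat_mul]
        congr 1
        ring

theorem abs_zonal_le_one {n : ℕ} (hn : 1 ≤ n) (k : ℕ) {t : ℝ} (ht : |t| ≤ 1) :
    |(zonal n k).eval t| ≤ 1 := by
  rcases hn.eq_or_lt with rfl | hn
  · exact abs_zonal_one_le k ht
  obtain ⟨a, rfl⟩ := Nat.exists_eq_add_of_le' hn
  refine le_of_mul_le_mul_right ?_ (integral_sin_pow_pos a)
  rw [one_mul]
  refine (abs_zonal_mul_integral_le a k t ht).trans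
    (intervalIntegral.integral_mono_on pi_pos.le ((by fun_prop : Continuous _).intervalIntegrable _ _)
      ((by fun_prop : Continuous _).intervalIntegrable _ _) fun x hx => ?_)
  have hs : 0 ≤ sin x := sin_nonneg_of_nonneg_of_le_pi hx.1 hx.2
  have h1 : 0 ≤ 1 - t ^ 2 := by nlinarith [abs_le.1 ht]
  refine mul_le_of_le_one_right (pow_nonneg hs a) (Real.exp_le_one_iff.2 ?_)
  have : 0 ≤ k * (1 - t ^ 2) / 2 * sin x ^ 2 := by positivity
  linarith

/-- On the shifted period [-π/2, π/2] Jordan's inequality |sin x| ≥ 2|x|/π gives a Gaussian majorant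
with integral π√π/16; finally √π ≤ 2. -/
theorem integral_exp_neg_sin_sq_le : ∫ x in (0)..π, rexp (-(64 * sin x ^ 2)) ≤ π / 8 := by
  have hper : Function.Periodic (fun x => rexp (-(64 * sin x ^ 2))) π := fun x => by
    simp [sin_add_pi]
  have h := hper.intervalIntegral_add_eq 0 (-(π / 2))
  rw [zero_add, show -(π / 2) + π = π / 2 by ring] at h
  have hpi := pi_pos
  have hb : 0 < 256 / π ^ 2 := by positivity
  calc ∫ x in (0)..π, rexp (-(64 * sin x ^ 2))
      = ∫ x in (-(π / 2))..(π / 2), rexp (-(64 * sin x ^ 2)) := h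
    _ ≤ ∫ x in (-(π / 2))..(π / 2), rexp (-(256 / π ^ 2) * x ^ 2) := by
      refine intervalIntegral.integral_mono_on (by linarith)
        ((by fun_prop : Continuous _).intervalIntegrable _ _)
        ((by fun_prop : Continuous _).intervalIntegrable _ _) fun x hx => ?_
      have h1 := mul_abs_le_abs_sin (abs_le.2 hx)
      have h2 : (2 / π * |x|) ^ 2 ≤ |sin x| ^ 2 := by gcongr
      rw [mul_pow, sq_abs, sq_abs] at h2
      refine Real.exp_le_exp.2 ?_
      have h3 : 256 / π ^ 2 * x ^ 2 = 64 * ((2 / π) ^ 2 * x ^ 2) := by ring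
      linarith
    _ ≤ ∫ x : ℝ, rexp (-(256 / π ^ 2) * x ^ 2) := by
      rw [intervalIntegral.integral_of_le (by linarith)]
      exact setIntegral_le_integral (integrable_exp_neg_mul_sq hb)
        (.of_forall fun x => (Real.exp_pos _).le)
    _ = √(π / (256 / π ^ 2)) := integral_gaussian _
    _ ≤ π / 8 := by
      refine Real.sqrt_le_iff.2 ⟨by positivity, ?_⟩
      rw [div_div_eq_mul_div, div_le_iff₀ (by norm_num)]
      nlinarith [pi_le_four, sq_nonneg π]

theorem le_integral_sin_pow (a : ℕ) : (1 / 4) ^ a * (π / 2) ≤ ∫ x in (0)..π, sin x ^ a := by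
  have hpi := pi_pos
  induction a using Nat.twoStepInduction with
  | zero =>
    simp
    linarith
  | one =>
    simp
    linarith [pi_le_four]
  | more a ih _ =>
    have hrec : ∫ x in (0)..π, sin x ^ (a + 2) =
        (a + 1) / (a + 2) * ∫ x in (0)..π, sin x ^ a := by
      rw [integral_sin_pow]
      simp
    rw [hrec]
    have h1 : (1 / 2 : ℝ) ≤ (a + 1) / (a + 2) := by
      rw [div_le_div_iff₀ (by norm_num) (by positivity)]
      linarith [a.cast_nonneg (α := ℝ)]
    calc (1 / 4 : ℝ) ^ (a + 2) * (π / 2) = 1 / 16 * ((1 / 4) ^ a * (π / 2)) := by ring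
      _ ≤ 1 / 2 * ((1 / 4) ^ a * (π / 2)) := by gcongr; norm_num
      _ ≤ _ := by gcongr

/-- With n = a + 2 the exponent is at least 32a sin² x + 64 sin² x. The first part is shared among
the a factors sin x, making each at most 1/8; the second leaves an integral of at most π/8. Division
by the lower bound (1/4)^a π/2 gives (1/2)^a · 1/4. -/
theorem abs_zonal_le_two_pow {n : ℕ} (hn : 2 ≤ n) (k : ℕ) {t : ℝ} (ht : |t| ≤ 1)
    (hk : 64 * n ≤ k * (1 - t ^ 2)) : |(zonal n k).eval t| ≤ (1 / 2) ^ n := by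
  obtain ⟨a, rfl⟩ := Nat.exists_eq_add_of_le' hn
  refine le_of_mul_le_mul_right ?_ (integral_sin_pow_pos a)
  calc |(zonal (a + 2) k).eval t| * ∫ x in (0)..π, sin x ^ a
      ≤ ∫ x in (0)..π, sin x ^ a * rexp (-(k * (1 - t ^ 2) / 2 * sin x ^ 2)) :=
        abs_zonal_mul_integral_le a k t ht
    _ ≤ ∫ x in (0)..π, (1 / 8) ^ a * rexp (-(64 * sin x ^ 2)) := by
      refine intervalIntegral.integral_mono_on pi_pos.le
        ((by fun_prop : Continuous _).intervalIntegrable _ _)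
        ((by fun_prop : Continuous _).intervalIntegrable _ _) fun x hx => ?_
      have hs : 0 ≤ sin x := sin_nonneg_of_nonneg_of_le_pi hx.1 hx.2
      -- By e^u ≥ 1 + u this reduces to 8s ≤ 1 + 32s² for s = sin x, a quadratic with negative
      -- discriminant.
      have h1 : sin x * rexp (-(32 * sin x ^ 2)) ≤ 1 / 8 := by
        rw [Real.exp_neg, mul_inv_le_iff₀ (Real.exp_pos _)]
        have := Real.add_one_le_exp (32 * sin x ^ 2)
        nlinarith [sq_nonneg (sin x - 1 / 8)]
      have h2 : rexp (-(k * (1 - t ^ 2) / 2 * sin x ^ 2)) ≤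
          rexp (-(32 * sin x ^ 2)) ^ a * rexp (-(64 * sin x ^ 2)) := by
        rw [← Real.exp_nat_mul, ← Real.exp_add]
        refine Real.exp_le_exp.2 ?_
        push_cast at hk
        nlinarith [sq_nonneg (sin x)]
      calc sin x ^ a * rexp (-(k * (1 - t ^ 2) / 2 * sin x ^ 2))
          ≤ sin x ^ a * (rexp (-(32 * sin x ^ 2)) ^ a * rexp (-(64 * sin x ^ 2))) := by gcongr
        _ = (sin x * rexp (-(32 * sin x ^ 2))) ^ a * rexp (-(64 * sin x ^ 2)) := by
          rw [mul_pow, mul_assoc]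
        _ ≤ _ := by gcongr
    _ = (1 / 8) ^ a * ∫ x in (0)..π, rexp (-(64 * sin x ^ 2)) :=
      intervalIntegral.integral_const_mul _ _
    _ ≤ (1 / 8) ^ a * (π / 8) := by gcongr; exact integral_exp_neg_sin_sq_le
    _ = (1 / 2) ^ (a + 2) * ((1 / 4) ^ a * (π / 2)) := by
      rw [show (1 / 8 : ℝ) = 1 / 2 * (1 / 4) by norm_num, mul_pow]
      ring
    _ ≤ _ := by gcongr; exact le_integral_sin_pow a

end SphHarm
end

/-! ### Sign flips and the averaged zonal harmonic. -/

noncomputable section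
namespace SphHarm

variable {𝕜 : Type*} [RCLike 𝕜] {d : ℕ}

theorem flip_apply (e : Fin d → ℤˣ) (x : Sph d) (i : Fin d) :
    (flip e x : Eucl d) i = ((e i : ℤ) : ℝ) * (x : Eucl d) i := rfl

theorem sign_mul_self (u : ℤˣ) : ((u : ℤ) : ℝ) * ((u : ℤ) : ℝ) = 1 := by
  rcases Int.units_eq_one_or u with rfl | rfl <;> simp

theorem flip_flip (e : Fin d → ℤˣ) (x : Sph d) : flip e (flip e x) = x := by
  apply Subtype.ext
  ext i
  rw [flip_apply, flip_apply, ← mul_assoc, sign_mul_self, one_mul]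

theorem inner_flip_left (e : Fin d → ℤˣ) (x y : Sph d) :
    inner ℝ (flip e x : Eucl d) (y : Eucl d) = inner ℝ (x : Eucl d) (flip e y : Eucl d) := by
  simp only [PiLp.inner_apply, flip_apply, RCLike.inner_apply, conj_trivial]
  exact Finset.sum_congr rfl fun i _ => by ring

/-- The coordinatewise product with a vector of signs, as an isometry of Euclidean space. -/
def flipIsometry (e : Fin d → ℤˣ) : Eucl d ≃ₗᵢ[ℝ] Eucl d :=
  LinearIsometryEquiv.piLpCongrRight 2 fun i =>
    if e i = 1 then LinearIsometryEquiv.refl ℝ ℝ else LinearIsometryEquiv.neg ℝ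

theorem flipIsometry_apply (e : Fin d → ℤˣ) (x : Eucl d) (i : Fin d) :
    flipIsometry e x i = ((e i : ℤ) : ℝ) * x i := by
  rcases Int.units_eq_one_or (e i) with h | h <;> simp [flipIsometry, h]

theorem flipIsometry_coe (e : Fin d → ℤˣ) (x : Sph d) : flipIsometry e x = flip e x := by
  ext i
  rw [flipIsometry_apply, flip_apply]

theorem continuous_flip (e : Fin d → ℤˣ) : Continuous (flip e) := by
  refine continuous_induced_rng.2 ?_
  have : (Subtype.val ∘ flip e) = fun x : Sph d => flipIsometry e x :=
    funext fun x => (flipIsometry_coe e x).symm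
  rw [this]
  exact (flipIsometry e).continuous.comp continuous_subtype_val

-- Surface measure is read off from the Lebesgue volume of the cone over a set, and a flip extends
-- to a linear isometry.
open scoped Pointwise in
theorem measurePreserving_flip (e : Fin d → ℤˣ) : MeasurePreserving (flip e) (unif d) (unif d) := by
  refine MeasurePreserving.smul_measure (μa := (volume : Measure (Eucl d)).toSphere)
    (μb := (volume : Measure (Eucl d)).toSphere) ⟨(continuous_flip e).measurable, ?_⟩ _
  ext s hs
  have hs' := (continuous_flip e).measurable hs
  rw [Measure.map_apply (continuous_flip e).measurable hs, Measure.toSphere_apply' _ hs,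
    Measure.toSphere_apply' _ hs',
    ← (flipIsometry e).measurePreserving.measure_preimage_emb
      (flipIsometry e).toHomeomorph.measurableEmbedding]
  congr 2
  ext x
  simp only [Set.mem_smul, Set.mem_preimage, Set.mem_image]
  constructor
  · rintro ⟨r, hr, _, ⟨y, hy, rfl⟩, h⟩
    refine ⟨r, hr, _, ⟨flip e y, hy, rfl⟩, (flipIsometry e).injective ?_⟩
    rw [map_smul, flipIsometry_coe, flip_flip]
    exact h
  · rintro ⟨r, hr, _, ⟨y, hy, rfl⟩, rfl⟩
    exact ⟨r, hr, _, ⟨flip e y, by rwa [flip_flip], rfl⟩,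
      by rw [map_smul, flipIsometry_coe]⟩

theorem integral_comp_flip (e : Fin d → ℤˣ) {F : Sph d → 𝕜} (hF : Continuous F) :
    ∫ y, F (flip e y) ∂(unif d) = ∫ y, F y ∂(unif d) := by
  have h := integral_map (f := F) (μ := unif d) (continuous_flip e).aemeasurable
    hF.aestronglyMeasurable
  rw [(measurePreserving_flip e).map_eq] at h
  exact h.symm

theorem ip_zonalFun_flip (e : Fin d → ℤˣ) {f : C(Sph d, 𝕜)} (hf : SignInvariant f) (k : ℕ)
    (x : Sph d) : ip f (zonalFun 𝕜 k (flip e x)) = ip f (zonalFun 𝕜 k x) := by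
  have hF : Continuous fun y => f y * conj (zonalFun 𝕜 k x y) :=
    f.continuous.mul (RCLike.continuous_conj.comp (zonalFun 𝕜 k x).continuous)
  rw [ip, ip, ← integral_comp_flip e hF]
  refine integral_congr_ae (.of_forall fun y => ?_)
  simp only [hf e y, zonalFun_apply, inner_flip_left]

theorem ip_sub_left (f g h : C(Sph d, 𝕜)) : ip (f - g) h = ip f h - ip g h := by
  rw [← inner_embL2, map_sub, inner_sub_right, inner_embL2, inner_embL2]

theorem ip_sum_right {ι : Type*} (s : Finset ι) (f : C(Sph d, 𝕜)) (g : ι → C(Sph d, 𝕜)) :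
    ip f (∑ i ∈ s, g i) = ∑ i ∈ s, ip f (g i) := by
  rw [← inner_embL2, map_sum, sum_inner]
  simp only [inner_embL2]

theorem norm_ip_le (f g : C(Sph d, 𝕜)) : ‖ip f g‖ ≤ norm2 f * norm2 g := by
  rw [← inner_embL2, ← norm_embL2, ← norm_embL2, mul_comm]
  exact norm_inner_le_norm _ _

theorem norm2_nonneg (f : C(Sph d, 𝕜)) : 0 ≤ norm2 f := Real.sqrt_nonneg _

/-- Since f - f_k is orthogonal to the zonal harmonic, the reproducing formula for f_k may be
evaluated on f itself. -/
theorem comp_apply (hd : 2 ≤ d) (k : ℕ) (f : C(Sph d, 𝕜)) (x : Sph d) :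
    comp k f x = (Module.finrank 𝕜 (harm 𝕜 d k) : 𝕜) * ip f (zonalFun 𝕜 k x) := by
  have h := ip_sub_comp k f _ (zonalFun_mem_harm hd k x)
  rw [ip_sub_left, sub_eq_zero] at h
  rw [h, finrank_mul_ip_zonalFun hd k x (comp_mem k f)]

theorem SignInvariant.comp (hd : 2 ≤ d) {f : C(Sph d, 𝕜)} (hf : SignInvariant f) (k : ℕ) :
    SignInvariant (comp k f) := by
  intro e x
  rw [comp_apply hd, comp_apply hd]
  rw [ip_zonalFun_flip e hf]

/-- Only the product of the flips matters, so the Gram matrix of the zonal harmonics at the sign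
vectors has constant row sums. -/
theorem inner_flip_flip {x : Sph d} (hx : x ∈ signVectors d) (e e' : Fin d → ℤˣ) :
    inner ℝ (flip e x : Eucl d) (flip e' x : Eucl d) = (∑ i, (((e * e') i : ℤˣ) : ℤ) : ℝ) / d := by
  have hsq : ∀ i, (x : Eucl d) i * (x : Eucl d) i = 1 / d := fun i => by
    have h : (1 / √(d : ℝ)) * (1 / √(d : ℝ)) = 1 / d := by
      rw [div_mul_div_comm, one_mul, Real.mul_self_sqrt d.cast_nonneg]
    rcases hx i with h' | h' <;> rw [h']
    · exact h
    · rw [neg_mul_neg, h]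
  simp only [PiLp.inner_apply, flip_apply, RCLike.inner_apply, conj_trivial, Finset.sum_div]
  refine Finset.sum_congr rfl fun i _ => ?_
  rw [Pi.mul_apply, Units.val_mul, Int.cast_mul]
  linear_combination ((e i : ℤ) : ℝ) * ((e' i : ℤ) : ℝ) * hsq i

theorem sum_sign_le_sub_two {e : Fin d → ℤˣ} (he : e ≠ 1) : (∑ i, ((e i : ℤ) : ℝ)) ≤ d - 2 := by
  obtain ⟨i, hi⟩ := Function.ne_iff.1 he
  have hi' : e i = -1 := (Int.units_eq_one_or (e i)).resolve_left hi
  have h : (1 - ((e i : ℤ) : ℝ)) ≤ ∑ j, (1 - ((e j : ℤ) : ℝ)) :=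
    Finset.single_le_sum (f := fun j => 1 - ((e j : ℤ) : ℝ)) (fun j _ => by
      rcases Int.units_eq_one_or (e j) with h | h <;> simp [h]) (Finset.mem_univ i)
  rw [Finset.sum_sub_distrib] at h
  simp [hi'] at h
  linarith

theorem abs_sum_sign_le (e : Fin d → ℤˣ) : |∑ i, ((e i : ℤ) : ℝ)| ≤ d := by
  refine (Finset.abs_sum_le_sum_abs _ _).trans (le_of_eq ?_)
  have : ∀ i, |((e i : ℤ) : ℝ)| = 1 := fun i => by
    rcases Int.units_eq_one_or (e i) with h | h <;> simp [h]
  simp [this]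

/-- The sum over the sign vectors of the values of a zonal harmonic of high degree. -/
theorem sum_abs_zonal_le_four (hd : 2 ≤ d) {k : ℕ} (hk : 16 * d ^ 2 ≤ k) :
    ∑ e : Fin d → ℤˣ, |(zonal (d - 1) k).eval ((∑ i, ((e i : ℤ) : ℝ)) / d)| ≤ 4 := by
  have hd0 : (0 : ℝ) < d := by
    have : 0 < d := by omega
    exact_mod_cast this
  have hcard : Fintype.card (Fin d → ℤˣ) = 2 ^ d := by simp
  have ht : ∀ e : Fin d → ℤˣ, |(∑ i, ((e i : ℤ) : ℝ)) / d| ≤ 1 := fun e => by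
    rw [abs_div, abs_of_pos hd0, div_le_one hd0]
    exact abs_sum_sign_le e
  have hone : ∀ e : Fin d → ℤˣ, |(zonal (d - 1) k).eval ((∑ i, ((e i : ℤ) : ℝ)) / d)| ≤ 1 :=
    fun e => abs_zonal_le_one (by omega) k (ht e)
  -- For d = 2 the decay bound is unavailable, but there are only four terms.
  rcases hd.eq_or_lt with rfl | hd3
  · refine (Finset.sum_le_card_nsmul _ _ 1 fun e _ => hone e).trans ?_
    rw [Finset.card_univ, hcard]
    norm_num
  have hbound : ∀ e : Fin d → ℤˣ, |(zonal (d - 1) k).eval ((∑ i, ((e i : ℤ) : ℝ)) / d)| ≤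
      (if e = 1 then 1 else 0) + (if e = -1 then 1 else 0) + (1 / 2) ^ (d - 1) := fun e => by
    have hp : (0 : ℝ) ≤ (1 / 2) ^ (d - 1) := by positivity
    by_cases h1 : e = 1
    · have := hone e
      rw [if_pos h1]
      split_ifs <;> linarith
    by_cases h2 : e = -1
    · have := hone e
      rw [if_pos h2, if_neg h1]
      linarith
    rw [if_neg h1, if_neg h2, zero_add, zero_add]
    refine abs_zonal_le_two_pow (by omega) k (ht e) ?_
    have h3 := sum_sign_le_sub_two h1
    have h4 := sum_sign_le_sub_two (e := -e) (fun h => h2 (by rw [← h, neg_neg]))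
    simp only [Pi.neg_apply, Units.val_neg, Int.cast_neg, Finset.sum_neg_distrib] at h4
    have h5 : (∑ i, ((e i : ℤ) : ℝ)) ^ 2 ≤ (d - 2 : ℝ) ^ 2 := sq_le_sq' (by linarith) h3
    have h6 : ((16 * d ^ 2 : ℕ) : ℝ) ≤ k := by exact_mod_cast hk
    push_cast at h6
    have h7 : ((∑ i, ((e i : ℤ) : ℝ)) / d) ^ 2 ≤ ((d - 2) / d : ℝ) ^ 2 := by
      rw [div_pow, div_pow]
      gcongr
    have h8 : 0 ≤ 1 - ((d - 2) / d : ℝ) ^ 2 := by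
      have : ((d - 2) / d : ℝ) = 1 - 2 / d := by field_simp
      have hd2 : (2 : ℝ) ≤ d := by exact_mod_cast hd
      have h9 : (2 : ℝ) / d ≤ 1 := (div_le_one hd0).2 hd2
      have h10 : (0 : ℝ) ≤ 2 / d := by positivity
      rw [this]
      nlinarith
    -- This identity is the origin of the threshold 16d²: the worst remaining height is (d - 2)/d.
    calc (64 * ((d - 1 : ℕ) : ℝ)) = 16 * d ^ 2 * (1 - ((d - 2) / d) ^ 2) := by
          rw [Nat.cast_sub (by omega)]
          field_simp
          push_cast
          ring
      _ ≤ k * (1 - ((d - 2) / d) ^ 2) := by gcongr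
      _ ≤ _ := by gcongr
  refine (Finset.sum_le_sum fun e _ => hbound e).trans ?_
  rw [Finset.sum_add_distrib, Finset.sum_add_distrib, Finset.sum_ite_eq', Finset.sum_ite_eq',
    if_pos (Finset.mem_univ _), if_pos (Finset.mem_univ _), Finset.sum_const, Finset.card_univ,
    hcard, nsmul_eq_mul]
  -- The total is 1 + 1 + 2^d · 2^{-(d-1)} = 4.
  obtain ⟨n, rfl⟩ := Nat.exists_eq_add_of_le' (show 1 ≤ d by omega)
  rw [Nat.add_sub_cancel, pow_succ]
  push_cast
  rw [mul_right_comm, ← mul_pow]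
  norm_num

/-- Reproducing G against its own summands turns D‖G‖² into the sum of the values of G at the 2^d
flips of x, all equal after reindexing the group of signs. -/
theorem finrank_mul_norm2_sq_le (hd : 2 ≤ d) {k : ℕ} (hk : 16 * d ^ 2 ≤ k) {x : Sph d}
    (hx : x ∈ signVectors d) :
    (Module.finrank 𝕜 (harm 𝕜 d k) : ℝ) *
      norm2 (∑ e : Fin d → ℤˣ, zonalFun 𝕜 k (flip e x)) ^ 2 ≤ 2 ^ d * 4 := by
  let G : C(Sph d, 𝕜) := ∑ e : Fin d → ℤˣ, zonalFun 𝕜 k (flip e x)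
  have hG : G ∈ harm 𝕜 d k := Submodule.sum_mem _ fun e _ => zonalFun_mem_harm hd k _
  have hval : ∀ e', G (flip e' x) = ((∑ e : Fin d → ℤˣ,
      (zonal (d - 1) k).eval ((∑ i, ((e i : ℤ) : ℝ)) / d) : ℝ) : 𝕜) := fun e' => by
    rw [ContinuousMap.sum_apply, RCLike.ofReal_sum, ← Equiv.sum_comp (Equiv.mulRight e')]
    refine Finset.sum_congr rfl fun e _ => ?_
    have h1 : (Equiv.mulRight e') e * e' = e := by
      ext i
      simp [mul_assoc]
    rw [zonalFun_apply, inner_flip_flip hx, h1]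
  have h : (Module.finrank 𝕜 (harm 𝕜 d k) : 𝕜) * ip G G = (((2 ^ d * ∑ e : Fin d → ℤˣ,
      (zonal (d - 1) k).eval ((∑ i, ((e i : ℤ) : ℝ)) / d) : ℝ)) : 𝕜) := by
    conv_lhs => arg 2; arg 2; rw [show G = ∑ e : Fin d → ℤˣ, zonalFun 𝕜 k (flip e x) from rfl]
    rw [ip_sum_right, Finset.mul_sum]
    simp only [finrank_mul_ip_zonalFun hd k _ hG, hval, Finset.sum_const, Finset.card_univ]
    simp only [Fintype.card_pi, Fintype.card_units_int, Finset.prod_const, Finset.card_univ,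
      Fintype.card_fin, nsmul_eq_mul]
    push_cast
    rfl
  rw [ip_self] at h
  have h' : (Module.finrank 𝕜 (harm 𝕜 d k) : ℝ) * norm2 G ^ 2 = 2 ^ d * ∑ e : Fin d → ℤˣ,
      (zonal (d - 1) k).eval ((∑ i, ((e i : ℤ) : ℝ)) / d) := by exact_mod_cast h
  rw [h']
  gcongr
  exact (Finset.sum_le_sum fun e _ => le_abs_self _).trans (sum_abs_zonal_le_four hd hk)

/-- Sign-invariant spherical harmonics of high degree are small at the sign vectors. -/
theorem norm_apply_signVector_le (hd : 2 ≤ d) {k : ℕ} (hk : 16 * d ^ 2 ≤ k) {h : C(Sph d, 𝕜)}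
    (hh : h ∈ harm 𝕜 d k) (hs : SignInvariant h) {x : Sph d} (hx : x ∈ signVectors d) :
    ‖h x‖ ≤ 2 * (2 : ℝ) ^ (-(d : ℝ) / 2) * √(N k d) * norm2 h := by
  let D : ℝ := Module.finrank 𝕜 (harm 𝕜 d k)
  let G : C(Sph d, 𝕜) := ∑ e : Fin d → ℤˣ, zonalFun 𝕜 k (flip e x)
  have hD : 0 ≤ D := Nat.cast_nonneg _
  have hDN : D ≤ N k d := finrank_harm_le hd (by nlinarith)
  have hG : D * norm2 G ^ 2 ≤ 2 ^ d * 4 := finrank_mul_norm2_sq_le hd hk hx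
  have h1 : (Module.finrank 𝕜 (harm 𝕜 d k) : 𝕜) * ip h G = 2 ^ d * h x := by
    rw [ip_sum_right, Finset.mul_sum]
    simp only [finrank_mul_ip_zonalFun hd k _ hh, hs _ x, Finset.sum_const, Finset.card_univ]
    simp
  have h2 : 2 ^ d * ‖h x‖ ≤ D * (norm2 h * norm2 G) := by
    have := congrArg norm h1
    rw [norm_mul, norm_mul, norm_pow, RCLike.norm_natCast, RCLike.norm_ofNat] at this
    rw [← this]
    exact mul_le_mul_of_nonneg_left (norm_ip_le h G) hD
  have hpow : ((2 : ℝ) ^ (-(d : ℝ) / 2)) ^ 2 * 2 ^ d = 1 := by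
    rw [← Real.rpow_natCast (_ ^ _), ← Real.rpow_mul (by norm_num), ← Real.rpow_natCast 2 d,
      ← Real.rpow_add (by norm_num), show -(d : ℝ) / 2 * ((2 : ℕ) : ℝ) + d = 0 by push_cast; ring,
      Real.rpow_zero]
  have hN : 0 ≤ N k d := hD.trans hDN
  have hn := norm2_nonneg h
  refine (sq_le_sq₀ (norm_nonneg _) (by positivity)).1 ?_
  -- After squaring, one factor D is absorbed in D‖G‖² and the other is bounded by N.
  have h3 : (2 ^ d * ‖h x‖) ^ 2 ≤ N k d * (2 ^ d * 4) * norm2 h ^ 2 := by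
    calc (2 ^ d * ‖h x‖) ^ 2 ≤ (D * (norm2 h * norm2 G)) ^ 2 := by gcongr
      _ = D * (D * norm2 G ^ 2) * norm2 h ^ 2 := by ring
      _ ≤ _ := by gcongr
  have h4 : (0 : ℝ) < (2 ^ d) ^ 2 := by positivity
  refine le_of_mul_le_mul_left ?_ h4
  calc ((2 : ℝ) ^ d) ^ 2 * ‖h x‖ ^ 2 = (2 ^ d * ‖h x‖) ^ 2 := by ring
    _ ≤ N k d * (2 ^ d * 4) * norm2 h ^ 2 := h3
    _ = N k d * (2 ^ d * 4) * norm2 h ^ 2 * (((2 : ℝ) ^ (-(d : ℝ) / 2)) ^ 2 * 2 ^ d) := by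
      rw [hpow, mul_one]
    _ = _ := by
      rw [mul_pow, mul_pow, mul_pow, Real.sq_sqrt hN]
      ring

theorem norm_comp_le (hd : 2 ≤ d) {f : C(Sph d, 𝕜)} (hf : SignInvariant f) {k : ℕ}
    (hk : 16 * d ^ 2 ≤ k) (hp : PeaksAtSigns (comp k f)) :
    ‖comp k f‖ ≤ 2 * (2 : ℝ) ^ (-(d : ℝ) / 2) * √(N k d) * norm2 (comp k f) := by
  have hn := norm2_nonneg (comp k f)
  rw [hp]
  exact Real.iSup_le (fun x => norm_apply_signVector_le hd hk (comp_mem k f) (hf.comp hd k) x.2)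
    (by positivity)

/-! ### Orthogonality of degrees, Bessel's inequality and exponential spreadness. -/

theorem ip_eq_zero_of_lt (hd : 2 ≤ d) {k l : ℕ} (hlk : l < k) {g h : C(Sph d, 𝕜)}
    (hh : h ∈ harm 𝕜 d k) (hg : g ∈ harm 𝕜 d l) : ip h g = 0 := by
  -- The projection onto H_l is computed by pairing with zonal harmonics of degree l, which are all
  -- orthogonal to h.
  have h0 : comp l h = 0 := by
    ext e
    rw [comp_apply hd, ip_zonalFun_of_lt hd hlk e hh, mul_zero, ContinuousMap.zero_apply]
  have := ip_sub_comp l h g hg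
  rwa [h0, sub_zero] at this

theorem ip_eq_zero_of_ne (hd : 2 ≤ d) {k l : ℕ} (hkl : k ≠ l) {g h : C(Sph d, 𝕜)}
    (hh : h ∈ harm 𝕜 d k) (hg : g ∈ harm 𝕜 d l) : ip h g = 0 := by
  rcases hkl.lt_or_gt with hlt | hlt
  · rw [← ip_conj_symm, ip_eq_zero_of_lt hd hlt hg hh, map_zero]
  · exact ip_eq_zero_of_lt hd hlt hh hg

/-- Bessel's inequality for the expansion in spherical harmonics. -/
theorem sum_norm2_comp_sq_le (hd : 2 ≤ d) (f : C(Sph d, 𝕜)) (s : Finset ℕ) :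
    ∑ k ∈ s, norm2 (comp k f) ^ 2 ≤ norm2 f ^ 2 := by
  let P : C(Sph d, 𝕜) := ∑ k ∈ s, comp k f
  have hself : ∀ k, ip f (comp k f) = ip (comp k f) (comp k f) := fun k => by
    have := ip_sub_comp k f _ (comp_mem k f)
    rwa [ip_sub_left, sub_eq_zero] at this
  have h1 : ip f P = ((∑ k ∈ s, norm2 (comp k f) ^ 2 : ℝ) : 𝕜) := by
    rw [ip_sum_right, RCLike.ofReal_sum]
    exact Finset.sum_congr rfl fun k _ => by rw [hself, ip_self]
  have h2 : ip P P = ((∑ k ∈ s, norm2 (comp k f) ^ 2 : ℝ) : 𝕜) := by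
    rw [← h1]
    simp only [P, ip_sum_right]
    refine Finset.sum_congr rfl fun k hk => ?_
    rw [← ip_conj_symm, ip_sum_right, Finset.sum_eq_single k, ip_conj_symm, hself]
    · intro l _ hl
      exact ip_eq_zero_of_ne hd hl.symm (comp_mem k f) (comp_mem l f)
    · exact fun h => absurd hk h
  rw [ip_self] at h2
  have h3 : norm2 P ^ 2 = ∑ k ∈ s, norm2 (comp k f) ^ 2 := by exact_mod_cast h2
  have h4 : norm2 P ^ 2 ≤ norm2 f * norm2 P := by
    have := norm_ip_le f P
    rwa [h1, ← h3, RCLike.norm_ofReal, abs_of_nonneg (sq_nonneg _)] at this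
  rw [← h3]
  have := norm2_nonneg P
  have := norm2_nonneg f
  nlinarith [sq_nonneg (norm2 f - norm2 P)]

theorem expSpread_of_norm_comp_le (f : ∀ d : ℕ, C(Sph d, 𝕜)) (I : ℕ → Set ℕ)
    (h : ∀ d, 2 ≤ d → ∀ k ∈ I d, ‖comp k (f d)‖ ≤
      2 * (2 : ℝ) ^ (-(d : ℝ) / 2) * √(N k d) * norm2 (comp k (f d))) : ExpSpread f I := by
  let ε : ℝ := (2 : ℝ) ^ (-(1 : ℝ) / 2)
  have hε : 0 < ε := by positivity
  have hε1 : ε < 1 := Real.rpow_lt_one_of_one_lt_of_neg (by norm_num) (by norm_num)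
  have hεd : ∀ d : ℕ, (2 : ℝ) ^ (-(d : ℝ) / 2) = ε ^ ((d : ℝ) ^ (1 : ℝ)) := fun d => by
    rw [Real.rpow_one, ← Real.rpow_mul (by norm_num)]
    congr 1
    ring
  -- By Bessel the squares of these numbers sum to at most 4 · 2^{-d}. No polynomial factor is
  -- needed; M = 1 only meets the requirement M > 0.
  refine ⟨fun d k => 2 * (2 : ℝ) ^ (-(d : ℝ) / 2) * (norm2 (comp k (f d)) / norm2 (f d)),
    fun d hd k hk => ?_, ε, 1, 1, 2, hε, hε1, one_pos, one_pos, fun d hd => ?_⟩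
  · have h1 := norm2_nonneg (comp k (f d))
    have h2 := norm2_nonneg (f d)
    refine ⟨by positivity, (h d hd k hk).trans (le_of_eq ?_)⟩
    -- If ‖f‖₂ = 0 the quotient is 0 by convention, and Bessel forces f_k to have norm 0 as well.
    rcases h2.eq_or_lt with h0 | hpos
    · have := sum_norm2_comp_sq_le hd (f d) {k}
      rw [Finset.sum_singleton, ← h0] at this
      have h3 : norm2 (comp k (f d)) = 0 := by
        refine pow_eq_zero_iff (two_ne_zero) |>.1 (le_antisymm ?_ (sq_nonneg _))
        simpa using this
      rw [h3, ← h0]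
      simp
    · field_simp
  · let A : ℝ := 2 * (2 : ℝ) ^ (-(d : ℝ) / 2)
    have hA : 0 ≤ A := by positivity
    have hsum : ∀ s : Finset (I d), ∑ k ∈ s, (A * (norm2 (comp k (f d)) / norm2 (f d))) ^ 2 ≤
        A ^ 2 := fun s => by
      have h1 := sum_norm2_comp_sq_le hd (f d) (s.map (Function.Embedding.subtype _))
      rw [Finset.sum_map] at h1
      simp only [mul_pow, div_pow, ← Finset.mul_sum, ← Finset.sum_div]
      exact mul_le_of_le_one_right (sq_nonneg _) (div_le_one_of_le₀ h1 (sq_nonneg _))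
    refine ⟨summable_of_sum_le (fun k => sq_nonneg _) hsum, ?_⟩
    refine (Real.sqrt_le_sqrt (Real.tsum_le_of_sum_le (fun k => sq_nonneg _) hsum)).trans ?_
    rw [Real.sqrt_sq hA, Real.rpow_one (d : ℝ)]
    have h1 : (2 : ℝ) ^ (-(d : ℝ) / 2) = ε ^ (d : ℝ) := by rw [hεd, Real.rpow_one]
    simp only [A, h1]
    have h2 : 0 < ε ^ (d : ℝ) := by positivity
    have h3 : (2 : ℝ) ≤ d := by exact_mod_cast hd
    nlinarith

end SphHarm
end

theorem mainTheorem11 {𝕜 : Type*} [RCLike 𝕜] :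
    (∀ d : ℕ, 2 ≤ d → ∀ f : C(SphHarm.Sph d, 𝕜), SphHarm.SignInvariant f →
      ∀ k : ℕ, 16 * d ^ 2 ≤ k → SphHarm.PeaksAtSigns (SphHarm.comp k f) →
        ‖SphHarm.comp k f‖ ≤
          2 * (2 : ℝ) ^ (-(d : ℝ) / 2) * √(SphHarm.N k d) * SphHarm.norm2 (SphHarm.comp k f)) ∧
    (∀ (f : ∀ d : ℕ, C(SphHarm.Sph d, 𝕜)) (I : ℕ → Set ℕ),
      (∀ d, 2 ≤ d → SphHarm.SignInvariant (f d)) →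
      (∀ d, 2 ≤ d → ∀ k ∈ I d, 16 * d ^ 2 ≤ k ∧ SphHarm.PeaksAtSigns (SphHarm.comp k (f d))) →
        SphHarm.ExpSpread f I) :=
  ⟨fun _ hd _ hf _ hk hp => SphHarm.norm_comp_le hd hf hk hp, fun f I hf hI =>
    SphHarm.expSpread_of_norm_comp_le f I fun d hd k hk =>
      SphHarm.norm_comp_le hd (hf d hd) (hI d hd k hk).1 (hI d hd k hk).2⟩
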